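/- **Setting.** Let $d\ge 1$, $I_\pm=\{\pm1,\dots,\pm d\}$, let $r:I_\pm\to\mathbb Z^d$ be a jump function with mean $\overline r=\frac1{2d}\sum_{\tau\in I_\pm} r(\tau)$, and let $C(\omega)$ be a random unitary matrix on $\mathbb C^{2d}$ (with canonical basis $\{|\tau\rangle\}_{\tau\in I_\pm}$ and projectors $P_\tau=|\tau\rangle\langle\tau|$) defined on a probability space $(\Omega,\mu)$. For $\overline\omega=(\omega_1,\omega_2,\dots)$ distributed according to $\mathbb P=\mu^{\otimes\mathbb N^*}$, with expectation denoted by $\mathbb E_\omega$, consider on $\mathbb C^{2d}\otimes\ell^2(\mathbb Z^d)$ the quantum walk $U_{\overline\omega}(n,0)=U_n\cdots U_1$, $U_s=\sum_{x\in\mathbb Z^d}\sum_{\tau\in I_\pm}P_\tau C(\omega_s)\otimes|x+r(\tau)\rangle\langle x|$. Let the initial state be $\Psi_0=\varphi_0\otimes|0\rangle$ with $\|\varphi_0\|=1$, let $W^\omega_k(n)=\|(U_{\overline\omega}(n,0)\Psi_0)(k)\|^2$ for $k\in\mathbb Z^d$, and let $X_n^\omega$ be a random vector in $\mathbb Z^d$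 with law $W^\omega(n)$. For $z\in\mathbb R^d\setminus\{0\}$ put $$Y_n^\omega=\frac{X_n^\omega-n\overline r}{\sqrt n},\qquad D_n^\omega=\langle z|Y_n^\omega\rangle\langle Y_n^\omega|z\rangle .$$ Let $\mathcal E=\int_\Omega C(\omega)\otimes\overline{C(\omega)}\,d\mu(\omega)$, acting on $\mathbb C^{2d}\otimes\mathbb C^{2d}$, let $D(y,y')$ be the diagonal matrix with entries $e^{i(y\cdot r(\tau)+y'\cdot r(\tau'))}$ in the basis $|\tau\otimes\tau'\rangle$, and let $\mathcal M(y,y')=D(y,y')\mathcal E$. **Assumption S.** For all $v\in\mathbb T^d=[0,2\pi)^d$, $\sigma(\mathcal M(-v,v))\cap\{|\lambda|=1\}=\{1\}$ and the eigenvalue $1$ is simple. Under Assumption S let $P$ be the orthogonal projector on the span of $\sum_\tau|\tau\otimes\tau\rangle$ (this is the spectral projector of $\mathcal M(-v,v)$ at $1$), let $Q=\mathbb I-P$, and let $S_v(1)$ be the reduced resolvent of $\mathcal M(-v,v)$ at $1$, that is, the inverse of $\mathcal M(-v,v)-1$ on the range of $Q$, and $0$ on the range of $P$. The diffusion matrix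 is $\mathbb D=\int_{[0,2\pi)^d}\mathbb D(v)\frac{dv}{(2\pi)^d}$, where $\mathbb D(v)$ is the symmetric matrix given, for $y\in\mathbb R^d$, by $$\langle y|\mathbb D(v)y\rangle=(y\cdot\overline r)^2-\frac1{2d}\sum_{\tau\in I_\pm}(y\cdot r(\tau))^2-\frac1d\sum_{\tau,\tau'\in I_\pm}(y\cdot r(\tau))(y\cdot r(\tau'))\,\langle\tau\otimes\tau|S_v(1)\,\tau'\otimes\tau'\rangle .$$ **Proposition.** Suppose Assumption S holds. (i) Let $z\in\mathbb R^d\setminus\{0\}$ and suppose that the random variables $\mathbb E_{W^\omega(n)}(D_n^\omega)$ converge in distribution, as $n\to\infty$, to a real random variable $D^\omega$ (possibly defined on another probability space). Then all $\mathbb E_{W^\omega(n)}(D_n^\omega)$ and $D^\omega$ are integrable, and $$\mathbb E_\omega(D^\omega)=\lim_{n\to\infty}\mathbb E_\omega\,\mathbb E_{W^\omega(n)}(D_n^\omega)=\langle z|\mathbb D z\rangle .$$ (ii) Consequently, if $\mathbb D^\omega$ is a random real matrix, almost surely symmetric, such that for every $z\in\mathbb R^d\setminus\{0\}$ the variables $\mathbb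 E_{W^\omega(n)}(D_n^\omega)$ converge in distribution to $D^\omega=\langle z|\mathbb D^\omega z\rangle$, then the entries of $\mathbb D^\omega$ are integrable and $\mathbb E_\omega(\mathbb D^\omega)=\mathbb D$. -/

import Mathlib

open MeasureTheory ProbabilityTheory Filter Topology
open scoped Kronecker

namespace RandomQuantumWalk

noncomputable section

/-- Internal labels `I_± = {±1, …, ±d}`: the pair `(j, ε)` stands for `ε (j + 1)`. -/
abbrev CoinIdx (d : ℕ) : Type := Fin d × ℤˣ

/-- The coin space `ℂ^{2d}`, with its Hermitian norm and basis indexed by `I_±`. -/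
abbrev CoinSpace (d : ℕ) : Type := EuclideanSpace ℂ (CoinIdx d)

/-- Wave functions `ψ : ℤ^d → ℂ^{2d}`. The states used below are finitely supported, hence lie
in `ℂ^{2d} ⊗ ℓ²(ℤ^d)`. -/
abbrev WaveFun (d : ℕ) : Type := (Fin d → ℤ) → CoinSpace d

/-- The localized state `φ ⊗ |0⟩`. -/
def localized {d : ℕ} (φ : CoinSpace d) : WaveFun d := fun x => if x = 0 then φ else 0

/-- One step `U = S (C ⊗ 1) = ∑_x ∑_τ P_τ C ⊗ |x + r(τ)⟩⟨x|`, that is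
`(U ψ)(x) = ∑_τ P_τ C ψ(x - r(τ))`. -/
def step {d : ℕ} (r : CoinIdx d → Fin d → ℤ) (C : Matrix (CoinIdx d) (CoinIdx d) ℂ)
    (ψ : WaveFun d) : WaveFun d :=
  fun x => ∑ τ, EuclideanSpace.single τ (C.mulVec (ψ (x - r τ)).ofLp τ)

/-- `U(n,0) ψ = U_n ⋯ U_1 ψ`, where the coin of the `s`-th step is `C (s - 1)`. -/
def evolve {d : ℕ} (r : CoinIdx d → Fin d → ℤ) (C : ℕ → Matrix (CoinIdx d) (CoinIdx d) ℂ)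
    (ψ : WaveFun d) : ℕ → WaveFun d
  | 0 => ψ
  | n + 1 => step r (C n) (evolve r C ψ n)

/-- `W_k(n)`, the probability of finding the walker at `k` at time `n`, started from
`φ₀ ⊗ |0⟩`. -/
def posProb {d : ℕ} (r : CoinIdx d → Fin d → ℤ) (C : ℕ → Matrix (CoinIdx d) (CoinIdx d) ℂ)
    (φ₀ : CoinSpace d) (n : ℕ) (k : Fin d → ℤ) : ℝ :=
  ‖evolve r C (localized φ₀) n k‖ ^ 2

/-- The mean jump `r̄ = (2d)⁻¹ ∑_τ r(τ)`. -/
def meanJump {d : ℕ} (r : CoinIdx d → Fin d → ℤ) : Fin d → ℝ :=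
  fun i => (2 * d : ℝ)⁻¹ * ∑ τ, (r τ i : ℝ)

/-- The rescaled centred position `(k - n r̄) / √n`. -/
def rescaled {d : ℕ} (r : CoinIdx d → Fin d → ℤ) (n : ℕ) (k : Fin d → ℤ) : Fin d → ℝ :=
  fun i => ((k i : ℝ) - n * meanJump r i) / √(n : ℝ)

/-- `𝔼_{W(n)}(D_n)` with `D_n = ⟨z|Y_n⟩⟨Y_n|z⟩`, `Y_n = (X_n - n r̄)/√n` and `X_n` of law `W(n)`.
The sum has finitely many nonzero terms. -/
def quadForm {d : ℕ} (r : CoinIdx d → Fin d → ℤ) (C : ℕ → Matrix (CoinIdx d) (CoinIdx d) ℂ)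
    (φ₀ : CoinSpace d) (z : Fin d → ℝ) (n : ℕ) : ℝ :=
  ∑' k : Fin d → ℤ, posProb r C φ₀ n k * ((z ⬝ᵥ rescaled r n k) * (rescaled r n k ⬝ᵥ z))

/-- The coin sequence `s ↦ C(ω_s)` attached to `ω̄ = (ω_s)_s`. -/
def coins {d : ℕ} {Ω : Type*} (C : Ω → Matrix.unitaryGroup (CoinIdx d) ℂ) (ω : ℕ → Ω) :
    ℕ → Matrix (CoinIdx d) (CoinIdx d) ℂ :=
  fun s => (C (ω s) : Matrix (CoinIdx d) (CoinIdx d) ℂ)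

/-- Matrices on `ℂ^{2d} ⊗ ℂ^{2d}` in the basis `|τ ⊗ τ'⟩`. -/
abbrev Mat2 (d : ℕ) : Type := Matrix (CoinIdx d × CoinIdx d) (CoinIdx d × CoinIdx d) ℂ

/-- `ℰ = 𝔼(C(ω) ⊗ \overline{C(ω)})`, entrywise. -/
def meanTensor {d : ℕ} {Ω : Type*} [MeasurableSpace Ω] (μ : Measure Ω)
    (C : Ω → Matrix.unitaryGroup (CoinIdx d) ℂ) : Mat2 d :=
  fun S T => ∫ ω, ((C ω : Matrix (CoinIdx d) (CoinIdx d) ℂ) ⊗ₖ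
    (C ω : Matrix (CoinIdx d) (CoinIdx d) ℂ).map (starRingEnd ℂ)) S T ∂μ

/-- The diagonal matrix `D(y,y')` with entries `exp(i(y·r(τ) + y'·r(τ')))`. -/
def phaseMat {d : ℕ} (r : CoinIdx d → Fin d → ℤ) (y y' : Fin d → ℝ) : Mat2 d :=
  Matrix.diagonal fun T => Complex.exp
    (Complex.I * ((∑ i, (y i * r T.1 i + y' i * r T.2 i) : ℝ) : ℂ))

/-- `ℳ(y,y') = D(y,y') ℰ`. -/
def meanMat {d : ℕ} {Ω : Type*} [MeasurableSpace Ω] (r : CoinIdx d → Fin d → ℤ) (μ : Measure Ω)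
    (C : Ω → Matrix.unitaryGroup (CoinIdx d) ℂ) (y y' : Fin d → ℝ) : Mat2 d :=
  phaseMat r y y' * meanTensor μ C

/-- Assumption S: for every `v`, the only eigenvalue of `ℳ(-v,v)` on the unit circle is `1`,
and it is (algebraically) simple. -/
def AssumptionS {d : ℕ} {Ω : Type*} [MeasurableSpace Ω] (r : CoinIdx d → Fin d → ℤ)
    (μ : Measure Ω) (C : Ω → Matrix.unitaryGroup (CoinIdx d) ℂ) : Prop :=
  ∀ v : Fin d → ℝ,
    spectrum ℂ (meanMat r μ C (-v) v) ∩ Metric.sphere (0 : ℂ) 1 = {1} ∧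
    (meanMat r μ C (-v) v).charpoly.rootMultiplicity 1 = 1

/-- `Ψ₁ = ∑_τ |τ ⊗ τ⟩`. -/
def psiOne (d : ℕ) : CoinIdx d × CoinIdx d → ℂ := fun T => if T.1 = T.2 then 1 else 0

/-- The projector `P = |Ψ₀⟩⟨Ψ₀|`, where `Ψ₀ = Ψ₁/‖Ψ₁‖` and `‖Ψ₁‖² = 2d`. -/
def projP (d : ℕ) : Mat2 d :=
  (2 * d : ℂ)⁻¹ • Matrix.vecMulVec (psiOne d) (star (psiOne d))

/-- The reduced resolvent `S_v(1)` of `ℳ(-v,v)` at the eigenvalue `1`: the inverse of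
`ℳ(-v,v) - 1` on the range of `Q = 1 - P`, and `0` on the range of `P`. Since
`ℳ(-v,v) = P + Q ℳ(-v,v) Q`, one has `(ℳ(-v,v) - Q)⁻¹ = P + S_v(1)`. -/
def reducedResolvent {d : ℕ} {Ω : Type*} [MeasurableSpace Ω] (r : CoinIdx d → Fin d → ℤ)
    (μ : Measure Ω) (C : Ω → Matrix.unitaryGroup (CoinIdx d) ℂ) (v : Fin d → ℝ) : Mat2 d :=
  (meanMat r μ C (-v) v - (1 - projP d))⁻¹ - projP d

/-- The diffusion matrix at `v`: the symmetric matrix `𝔻(v)` with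
`⟨y|𝔻(v)y⟩ = (y·r̄)² - (2d)⁻¹ ∑_τ (y·r(τ))²
  - d⁻¹ ∑_{τ,τ'} (y·r(τ)) (y·r(τ')) ⟨τ⊗τ|S_v(1)|τ'⊗τ'⟩`.
Equivalently, `log λ₁(y,v) = i y·r̄ - ⟨y|𝔻(v)y⟩/2 + O(|y|³)` for the eigenvalue `λ₁(y,v)` of
`ℳ(y-v,v)` close to `1`. -/
def diffusionAt {d : ℕ} {Ω : Type*} [MeasurableSpace Ω] (r : CoinIdx d → Fin d → ℤ)
    (μ : Measure Ω) (C : Ω → Matrix.unitaryGroup (CoinIdx d) ℂ) (v : Fin d → ℝ) :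
    Matrix (Fin d) (Fin d) ℂ :=
  fun i j => (meanJump r i * meanJump r j : ℂ)
    - (2 * d : ℂ)⁻¹ * ∑ τ, (r τ i : ℂ) * (r τ j : ℂ)
    - (2 * d : ℂ)⁻¹ * ∑ τ, ∑ τ', ((r τ i : ℂ) * (r τ' j : ℂ) + (r τ j : ℂ) * (r τ' i : ℂ)) *
        reducedResolvent r μ C v (τ, τ) (τ', τ')

/-- The averaged diffusion matrix `𝔻 = (2π)^{-d} ∫_{[0,2π)^d} 𝔻(v) dv`. -/
def diffusion {d : ℕ} {Ω : Type*} [MeasurableSpace Ω] (r : CoinIdx d → Fin d → ℤ)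
    (μ : Measure Ω) (C : Ω → Matrix.unitaryGroup (CoinIdx d) ℂ) : Matrix (Fin d) (Fin d) ℂ :=
  fun i j => ((2 * Real.pi : ℂ) ^ d)⁻¹ *
    ∫ v in Set.univ.pi (fun _ : Fin d => Set.Ico (0 : ℝ) (2 * Real.pi)), diffusionAt r μ C v i j

end

end RandomQuantumWalk

namespace RandomQuantumWalk

/-!
The expectation over the coins of `ψ_n(x) ⊗ conj ψ_n(x')`, Fourier transformed at `(-v, v)`,
evolves linearly by `ℳ(-v,v)`. Weighting it by powers of the centred displacement `z · (x - n r̄)`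
gives moments that satisfy a triangular system of affine recursions, and integrating their traces
over `v` recovers the averaged moments of the walk. `ℳ(-v,v)` is a contraction fixing `Ψ₁`; under
Assumption S its powers are summable on the complement of `Ψ₁`, uniformly in `v` by compactness,
and the jump is centred, so each two powers of the displacement cost only one power of `n`. At
second order, Cesàro averaging of the recursion produces the reduced-resolvent formula for `𝔻(v)`.
At fourth order, the bound `O(n²)` and the Cauchy–Schwarz inequality bound the second moments of
`𝔼_{W(n)}(D_n)`, so convergence in distribution entails convergence of the means. Polarization
then identifies the entries of the mean of a random diffusion matrix.
-/

section AffineRecursion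

lemma sum_norm_pow_le {R : Type*} [SeminormedRing R] {a : R} {N : ℕ} {K q : ℝ}
    (hK : ∀ j, ‖a ^ j‖ ≤ K) (hq : q < 1) (haN : ‖a ^ N‖ ≤ q) (n : ℕ) :
    ∑ j ∈ Finset.range n, ‖a ^ j‖ ≤ N * K / (1 - q) := by
  have split : ∑ j ∈ Finset.range n, ‖a ^ j‖ ≤
      ∑ j ∈ Finset.range N, ‖a ^ j‖ + ∑ j ∈ Finset.range n, ‖a ^ (N + j)‖ := by
    rw [← Finset.sum_range_add (fun j => ‖a ^ j‖)]
    exact Finset.sum_le_sum_of_subset_of_nonneg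
      (Finset.range_subset_range.2 (Nat.le_add_left n N)) fun _ _ _ => norm_nonneg _
  have head : ∑ j ∈ Finset.range N, ‖a ^ j‖ ≤ N * K := by
    simpa using Finset.sum_le_card_nsmul (Finset.range N) _ _ fun j _ => hK j
  have tail : ∑ j ∈ Finset.range n, ‖a ^ (N + j)‖ ≤ q * ∑ j ∈ Finset.range n, ‖a ^ j‖ := by
    rw [Finset.mul_sum]
    refine Finset.sum_le_sum fun j _ => ?_
    rw [pow_add]
    exact (norm_mul_le _ _).trans (by gcongr)
  rw [le_div_iff₀ (sub_pos.2 hq)]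
  linarith

variable {𝕜 E : Type*} [NontriviallyNormedField 𝕜] [NormedAddCommGroup E] [NormedSpace 𝕜 E]

lemma eq_sum_of_affine_recursion {T : E →L[𝕜] E} {w f : ℕ → E}
    (hw : ∀ n, w (n + 1) = T (w n) + f n) (n : ℕ) :
    w n = (T ^ n) (w 0) + ∑ j ∈ Finset.range n, (T ^ j) (f (n - 1 - j)) := by
  induction n with
  | zero => simp
  | succ n ih =>
    rw [hw, Finset.sum_range_succ', ← add_assoc, pow_succ', ih, map_add, map_sum]
    simp only [pow_succ', mul_apply_eq_comp, pow_zero, one_apply_eq_self, Nat.add_sub_cancel,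
      Nat.sub_zero, Nat.sub_sub, add_comm 1]

lemma norm_le_of_affine_recursion {T : E →L[𝕜] E} {B : ℝ}
    (hB : ∀ n, ∑ j ∈ Finset.range n, ‖T ^ j‖ ≤ B) {w f : ℕ → E}
    (hw : ∀ n, w (n + 1) = T (w n) + f n) {n : ℕ} {c : ℝ} (h0 : ‖w 0‖ ≤ c)
    (hf : ∀ j < n, ‖f j‖ ≤ c) : ‖w n‖ ≤ B * c := by
  have hc : 0 ≤ c := (norm_nonneg _).trans h0
  have hsum : ‖∑ j ∈ Finset.range n, (T ^ j) (f (n - 1 - j))‖ ≤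
      (∑ j ∈ Finset.range n, ‖T ^ j‖) * c := by
    rw [Finset.sum_mul]
    refine norm_sum_le_of_le _ fun j hj => (T ^ j).le_opNorm_of_le (hf _ ?_)
    have := Finset.mem_range.1 hj
    omega
  calc ‖w n‖ ≤ ‖T ^ n‖ * c + (∑ j ∈ Finset.range n, ‖T ^ j‖) * c := by
        rw [eq_sum_of_affine_recursion hw]
        exact norm_add_le_of_le ((T ^ n).le_opNorm_of_le h0) hsum
    _ = (∑ j ∈ Finset.range (n + 1), ‖T ^ j‖) * c := by
        rw [Finset.sum_range_succ, add_comm, add_mul]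
    _ ≤ B * c := by gcongr; exact hB _

end AffineRecursion

section Growth

variable {ι E : Type*} [NormedAddCommGroup E]

/-- `g i n = O(n ^ k)`, uniformly in the parameter `i`; the shift by one covers `n = 0`. -/
def UniformGrowth (k : ℕ) (g : ι → ℕ → E) : Prop :=
  (fun p : ι × ℕ => g p.1 p.2) =O[⊤] fun p : ι × ℕ => ((p.2 : ℝ) + 1) ^ k

namespace UniformGrowth

variable {k l : ℕ} {g : ι → ℕ → E}

lemma iff_exists_bound :
    UniformGrowth k g ↔ ∃ c : ℝ, ∀ i n, ‖g i n‖ ≤ c * ((n : ℝ) + 1) ^ k := by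
  have hpos (n : ℕ) : ‖((n : ℝ) + 1) ^ k‖ = ((n : ℝ) + 1) ^ k := Real.norm_of_nonneg (by positivity)
  simp only [UniformGrowth, Asymptotics.isBigO_top, Prod.forall, hpos]

lemma zero_iff_exists_bound : UniformGrowth 0 g ↔ ∃ c : ℝ, ∀ i n, ‖g i n‖ ≤ c := by
  simp [iff_exists_bound]

lemma exists_nonneg_bound (hg : UniformGrowth k g) :
    ∃ c : ℝ, 0 ≤ c ∧ ∀ i n, ‖g i n‖ ≤ c * ((n : ℝ) + 1) ^ k := by
  obtain ⟨c, hc⟩ := iff_exists_bound.1 hg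
  exact ⟨max c 0, le_max_right _ _, fun i n => (hc i n).trans (by gcongr; exact le_max_left _ _)⟩

lemma mono (hg : UniformGrowth k g) (hkl : k ≤ l) : UniformGrowth l g := by
  obtain ⟨c, hc0, hc⟩ := hg.exists_nonneg_bound
  refine iff_exists_bound.2 ⟨c, fun i n => (hc i n).trans ?_⟩
  gcongr
  exact le_add_of_nonneg_left n.cast_nonneg

lemma add {h : ι → ℕ → E} (hg : UniformGrowth k g) (hh : UniformGrowth k h) :
    UniformGrowth k fun i n => g i n + h i n :=
  Asymptotics.IsBigO.add hg hh

lemma sum {J : Type*} {s : Finset J} {g : J → ι → ℕ → E} (hg : ∀ j ∈ s, UniformGrowth k (g j)) :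
    UniformGrowth k fun i n => ∑ j ∈ s, g j i n := by
  simpa only [UniformGrowth, Finset.sum_fn] using Asymptotics.IsBigO.sum hg

lemma of_increment {f : ι → ℕ → E} {K : ℝ} (h0 : ∀ i, ‖g i 0‖ ≤ K)
    (hg : ∀ i n, g i (n + 1) = g i n + f i n) (hf : UniformGrowth k f) :
    UniformGrowth (k + 1) g := by
  obtain ⟨c, hc0, hc⟩ := hf.exists_nonneg_bound
  refine iff_exists_bound.2 ⟨max K c, fun i n => ?_⟩
  have : 0 ≤ max K c := hc0.trans (le_max_right _ _)
  induction n with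
  | zero => simpa using Or.inl (h0 i)
  | succ n ih =>
    have hle : ((n : ℝ) + 1) ^ k ≤ ((n + 1 : ℕ) + 1 : ℝ) ^ k := by gcongr; simp
    calc ‖g i (n + 1)‖ ≤ max K c * ((n : ℝ) + 1) ^ (k + 1) + c * ((n : ℝ) + 1) ^ k := by
          rw [hg]
          exact norm_add_le_of_le ih (hc i n)
      _ ≤ max K c * (((n : ℝ) + 1) ^ k * (n + 1)) + max K c * ((n : ℝ) + 1) ^ k := by
          rw [pow_succ]
          gcongr
          exact le_max_right _ _
      _ = max K c * (((n : ℝ) + 1) ^ k * ((n + 1 : ℕ) + 1)) := by push_cast; ring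
      _ ≤ max K c * ((n + 1 : ℕ) + 1 : ℝ) ^ (k + 1) := by rw [pow_succ]; gcongr

variable {𝕜 F : Type*} [NontriviallyNormedField 𝕜] [NormedSpace 𝕜 E] [NormedAddCommGroup F]
  [NormedSpace 𝕜 F]

lemma clm_apply (hg : UniformGrowth k g) {L : ι → E →L[𝕜] F} {K : ℝ} (hL : ∀ i, ‖L i‖ ≤ K) :
    UniformGrowth k fun i n => L i (g i n) := by
  obtain ⟨c, hc⟩ := iff_exists_bound.1 hg
  refine iff_exists_bound.2 ⟨K * c, fun i n => ?_⟩
  rw [mul_assoc]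
  exact (L i).le_of_opNorm_le_of_le (hL i) (hc i n)

lemma map (hg : UniformGrowth k g) (L : E →L[𝕜] F) : UniformGrowth k fun i n => L (g i n) :=
  hg.clm_apply (L := fun _ => L) fun _ => le_rfl

lemma const_smul (hg : UniformGrowth k g) (a : 𝕜) : UniformGrowth k fun i n => a • g i n :=
  Asymptotics.IsBigO.const_smul_left hg a

lemma of_affine_recursion {T : ι → E →L[𝕜] E} {B K : ℝ}
    (hB : ∀ i n, ∑ j ∈ Finset.range n, ‖T i ^ j‖ ≤ B) {f : ι → ℕ → E}
    (h0 : ∀ i, ‖g i 0‖ ≤ K) (hg : ∀ i n, g i (n + 1) = T i (g i n) + f i n)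
    (hf : UniformGrowth k f) : UniformGrowth k g := by
  obtain ⟨c, hc0, hc⟩ := hf.exists_nonneg_bound
  refine iff_exists_bound.2 ⟨B * max K c, fun i n => ?_⟩
  rw [mul_assoc]
  have hmax : 0 ≤ max K c := hc0.trans (le_max_right _ _)
  refine norm_le_of_affine_recursion (hB i) (hg i) ?_ fun j hj => (hc i j).trans ?_
  · exact (h0 i).trans ((le_max_left _ _).trans (le_mul_of_one_le_right hmax
      (one_le_pow₀ (le_add_of_nonneg_left n.cast_nonneg))))
  · gcongr
    exact le_max_right _ _

end UniformGrowth

end Growth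

section Cesaro

variable {𝕜 E : Type*} [RCLike 𝕜] [NormedAddCommGroup E] [NormedSpace 𝕜 E]

lemma tendsto_cesaro_of_affine_recursion {T R : E →L[𝕜] E} {w f : ℕ → E}
    (hw : ∀ n, w (n + 1) = T (w n) + f n) (hR : ∀ n, R (w n - T (w n)) = w n) {c : ℝ}
    (hc : ∀ n, ‖w n‖ ≤ c) {a : E}
    (hf : Tendsto (fun n : ℕ => (n : 𝕜)⁻¹ • ∑ j ∈ Finset.range n, f j) atTop (𝓝 a)) :
    Tendsto (fun n : ℕ => (n : 𝕜)⁻¹ • ∑ j ∈ Finset.range n, w j) atTop (𝓝 (R a)) := by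
  have sum_eq (n : ℕ) :
      ∑ j ∈ Finset.range n, w j = R (∑ j ∈ Finset.range n, f j - (w n - w 0)) := by
    rw [← Finset.sum_range_sub, ← Finset.sum_sub_distrib, map_sum]
    refine Finset.sum_congr rfl fun j _ => ?_
    rw [hw, ← hR j]
    congr 1
    rw [hR]
    abel
  have boundary : Tendsto (fun n : ℕ => (n : 𝕜)⁻¹ • (w n - w 0)) atTop (𝓝 0) := by
    refine squeeze_zero_norm (a := fun n : ℕ => (n : ℝ)⁻¹ * (c + c)) (fun n => ?_) ?_
    · rw [norm_smul, norm_inv, RCLike.norm_natCast]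
      gcongr
      exact norm_sub_le_of_le (hc n) (hc 0)
    · simpa using (tendsto_inv_atTop_zero.comp tendsto_natCast_atTop_atTop).mul_const (c + c)
  have limit := (R.continuous.tendsto _).comp (hf.sub boundary)
  rw [sub_zero] at limit
  refine limit.congr fun n => ?_
  simp only [Function.comp_apply, sum_eq, map_smul, smul_sub, map_sub]

end Cesaro

section Moments

variable {𝕜 E ι : Type*}

/-- `u m n` plays the role of the moment of order `m` at time `n` of a walk with transfer operator
`M` and infinitesimal translation `A`: formally `∑ m, t ^ m • u m n / m!` is
`(exp (t A) M) ^ n` applied to its initial value. -/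
def IsMomentSeq [NontriviallyNormedField 𝕜] [NormedAddCommGroup E] [NormedSpace 𝕜 E]
    (A M : E →L[𝕜] E) (u : ℕ → ℕ → E) : Prop :=
  ∀ m n, u m (n + 1) = ∑ j ∈ Finset.range (m + 1), (m.choose j : 𝕜) • (A ^ j) (M (u (m - j) n))

/-- `e` is a fixed vector and `ℓ` an invariant linear form of `M`, normalised by `ℓ e = 1`, so that
`x ↦ ℓ x • e` is a projection commuting with `M`. -/
structure IsFixedPair [NontriviallyNormedField 𝕜] [NormedAddCommGroup E] [NormedSpace 𝕜 E]
    (M : E →L[𝕜] E) (e : E) (ℓ : E →L[𝕜] 𝕜) : Prop where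
  map_vec : M e = e
  form_map : ∀ x, ℓ (M x) = ℓ x
  form_vec : ℓ e = 1

section General

variable [NontriviallyNormedField 𝕜] [NormedAddCommGroup E] [NormedSpace 𝕜 E]
  {A M X : E →L[𝕜] E} {e : E} {ℓ : E →L[𝕜] 𝕜}

/-- The part `M - ℓ(·) e` of `M` complementary to the projection `x ↦ ℓ x • e`. -/
def deflate (M : E →L[𝕜] E) (e : E) (ℓ : E →L[𝕜] 𝕜) : E →L[𝕜] E :=
  M - ℓ.smulRight e

lemma deflate_apply (x : E) : deflate M e ℓ x = M x - ℓ x • e := rfl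

/-- The component of `x` in the kernel of `ℓ`, along `e`. -/
def remainder (e : E) (ℓ : E →L[𝕜] 𝕜) : E →L[𝕜] E := deflate (.id 𝕜 E) e ℓ

lemma remainder_apply (x : E) : remainder e ℓ x = x - ℓ x • e := rfl

lemma remainder_add_smul (x : E) : remainder e ℓ x + ℓ x • e = x := sub_add_cancel _ _

namespace IsFixedPair

lemma form_remainder (h : IsFixedPair M e ℓ) (x : E) : ℓ (remainder e ℓ x) = 0 := by
  simp [remainder_apply, h.form_vec]

lemma form_deflate (h : IsFixedPair M e ℓ) (x : E) : ℓ (deflate M e ℓ x) = 0 := by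
  simp [deflate_apply, h.form_map, h.form_vec]

lemma form_map_pow (h : IsFixedPair M e ℓ) (j : ℕ) (x : E) : ℓ ((M ^ j) x) = ℓ x := by
  induction j with
  | zero => rfl
  | succ j ih => rw [pow_succ', mul_apply_eq_comp, h.form_map, ih]

lemma deflate_pow_succ (h : IsFixedPair M e ℓ) (j : ℕ) :
    deflate M e ℓ ^ (j + 1) = deflate (M ^ (j + 1)) e ℓ := by
  induction j with
  | zero => simp
  | succ j ih =>
    ext x
    rw [pow_succ', ih, pow_succ' M (j + 1)]
    simp only [mul_apply_eq_comp, deflate_apply, map_sub, map_smul, h.form_map_pow, h.map_vec,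
      h.form_vec, one_smul, sub_self, smul_zero, sub_zero]

lemma norm_deflate_pow_le (h : IsFixedPair M e ℓ) (hM : ‖M‖ ≤ 1) (j : ℕ) :
    ‖deflate M e ℓ ^ j‖ ≤ 1 + ‖ℓ.smulRight e‖ := by
  cases j with
  | zero => exact ContinuousLinearMap.norm_id_le.trans (le_add_of_nonneg_right (norm_nonneg _))
  | succ j =>
    rw [h.deflate_pow_succ]
    exact norm_sub_le_of_le ((norm_pow_le' M j.succ_pos).trans (pow_le_one₀ (norm_nonneg _) hM))
      le_rfl

lemma remainder_map (h : IsFixedPair M e ℓ) (x : E) :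
    remainder e ℓ (M x) = deflate M e ℓ (remainder e ℓ x) := by
  simp [deflate_apply, remainder_apply, h.form_map, h.map_vec, h.form_vec]

lemma form_map_remainder (h : IsFixedPair M e ℓ) (hA : ℓ (A e) = 0) (x : E) :
    ℓ (A (M (remainder e ℓ x))) = ℓ (A (M x)) := by
  simp [remainder_apply, h.map_vec, hA]

end IsFixedPair

/-- The contribution of the lower moments to the moment of order `m` in one step. -/
def momentForcing (A M : E →L[𝕜] E) (u : ℕ → ℕ → E) (m n : ℕ) : E :=
  ∑ j ∈ Finset.range m, (m.choose (j + 1) : 𝕜) • (A ^ (j + 1)) (M (u (m - (j + 1)) n))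

namespace IsMomentSeq

variable {u : ℕ → ℕ → E}

lemma succ_eq (hu : IsMomentSeq A M u) (m n : ℕ) :
    u m (n + 1) = M (u m n) + momentForcing A M u m n := by
  rw [hu, Finset.sum_range_succ', momentForcing, add_comm]
  simp

lemma form_succ (hu : IsMomentSeq A M u) (hM : IsFixedPair M e ℓ) (m n : ℕ) :
    ℓ (u m (n + 1)) = ℓ (u m n) + ℓ (momentForcing A M u m n) := by
  rw [hu.succ_eq, map_add, hM.form_map]

lemma remainder_succ (hu : IsMomentSeq A M u) (hM : IsFixedPair M e ℓ) (m n : ℕ) :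
    remainder e ℓ (u m (n + 1)) = deflate M e ℓ (remainder e ℓ (u m n)) +
      remainder e ℓ (momentForcing A M u m n) := by
  rw [hu.succ_eq, map_add, hM.remainder_map]

end IsMomentSeq

/-- The source of the diffusive scaling: the mean of order `m + 1` is driven by the remainder of
order `m`, which for odd `m` grows more slowly than the moment itself. -/
lemma IsFixedPair.form_momentForcing_succ (hM : IsFixedPair M e ℓ) (hA : ℓ (A e) = 0)
    (u : ℕ → ℕ → E) (m n : ℕ) :
    ℓ (momentForcing A M u (m + 1) n) = (m + 1 : 𝕜) * ℓ (A (M (remainder e ℓ (u m n)))) +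
      ∑ j ∈ Finset.range m,
        ((m + 1).choose (j + 2) : 𝕜) * ℓ ((A ^ (j + 2)) (M (u (m - (j + 1)) n))) := by
  rw [momentForcing, Finset.sum_range_succ', map_add, map_sum, hM.form_map_remainder hA, add_comm]
  simp

section Growth

variable {M : ι → E →L[𝕜] E} {u : ι → ℕ → ℕ → E} {B K C : ℝ} {m : ℕ}

lemma uniformGrowth_momentForcing (hK : ∀ i, ‖M i‖ ≤ K)
    (hu : ∀ l < m, UniformGrowth ((l + 1) / 2) fun i n => u i l n) :
    UniformGrowth (m / 2) fun i n => momentForcing A (M i) (u i) m n := by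
  refine UniformGrowth.sum fun j hj => ?_
  have hlt := Finset.mem_range.1 hj
  have hlower := ((hu (m - (j + 1)) (by omega)).clm_apply hK).map (A ^ (j + 1))
  exact (hlower.const_smul _).mono (by omega)

lemma uniformGrowth_form_momentForcing (hM : ∀ i, IsFixedPair (M i) e ℓ) (hA : ℓ (A e) = 0)
    (hK : ∀ i, ‖M i‖ ≤ K) (hu : ∀ l < m, UniformGrowth ((l + 1) / 2) fun i n => u i l n)
    (hrem : UniformGrowth (m / 2) fun i n => remainder e ℓ (u i m n)) :
    UniformGrowth (m / 2) fun i n => ℓ (momentForcing A (M i) (u i) (m + 1) n) := by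
  simp only [(hM _).form_momentForcing_succ hA]
  refine ((((hrem.clm_apply hK).map A).map ℓ).const_smul (m + 1 : 𝕜)).add
    (UniformGrowth.sum fun j hj => ?_)
  have hlt := Finset.mem_range.1 hj
  have hlower := (((hu (m - (j + 1)) (by omega)).clm_apply hK).map (A ^ (j + 2))).map ℓ
  exact (hlower.const_smul ((m + 1).choose (j + 2) : 𝕜)).mono (by omega)

lemma IsMomentSeq.uniformGrowth_remainder (hu : ∀ i, IsMomentSeq A (M i) (u i))
    (hM : ∀ i, IsFixedPair (M i) e ℓ) (hK : ∀ i, ‖M i‖ ≤ K)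
    (hB : ∀ i n, ∑ j ∈ Finset.range n, ‖deflate (M i) e ℓ ^ j‖ ≤ B) (h0 : ∀ i, ‖u i m 0‖ ≤ C)
    (hlower : ∀ l < m, UniformGrowth ((l + 1) / 2) fun i n => u i l n) :
    UniformGrowth (m / 2) fun i n => remainder e ℓ (u i m n) :=
  .of_affine_recursion hB (fun i => (remainder e ℓ).le_opNorm_of_le (h0 i))
    (fun i => (hu i).remainder_succ (hM i) m) ((uniformGrowth_momentForcing hK hlower).map _)

lemma IsMomentSeq.uniformGrowth_form (hu : ∀ i, IsMomentSeq A (M i) (u i))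
    (hM : ∀ i, IsFixedPair (M i) e ℓ) (hA : ℓ (A e) = 0) (hK : ∀ i, ‖M i‖ ≤ K)
    (h0 : ∀ i, ‖u i m 0‖ ≤ C) (hlower : ∀ l < m, UniformGrowth ((l + 1) / 2) fun i n => u i l n)
    (hrem : ∀ l < m, UniformGrowth (l / 2) fun i n => remainder e ℓ (u i l n)) :
    UniformGrowth ((m + 1) / 2) fun i n => ℓ (u i m n) := by
  have init (i) : ‖ℓ (u i m 0)‖ ≤ ‖ℓ‖ * C := ℓ.le_opNorm_of_le (h0 i)
  cases m with
  | zero =>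
    refine .zero_iff_exists_bound.2 ⟨‖ℓ‖ * C, fun i n => ?_⟩
    induction n with
    | zero => exact init i
    | succ n ih => simpa [(hu i).form_succ (hM i), momentForcing] using ih
  | succ m =>
    rw [show (m + 1 + 1) / 2 = m / 2 + 1 by omega]
    exact .of_increment init (fun i => (hu i).form_succ (hM i) (m + 1))
      (uniformGrowth_form_momentForcing hM hA hK (fun l hl => hlower l (by omega))
        (hrem m m.lt_succ_self))

theorem IsMomentSeq.uniformGrowth (hu : ∀ i, IsMomentSeq A (M i) (u i))
    (hM : ∀ i, IsFixedPair (M i) e ℓ) (hA : ℓ (A e) = 0) (hK : ∀ i, ‖M i‖ ≤ K)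
    (hB : ∀ i n, ∑ j ∈ Finset.range n, ‖deflate (M i) e ℓ ^ j‖ ≤ B) (h0 : ∀ i m, ‖u i m 0‖ ≤ C)
    (m : ℕ) :
    UniformGrowth (m / 2) (fun i n => remainder e ℓ (u i m n)) ∧
      UniformGrowth ((m + 1) / 2) fun i n => u i m n := by
  induction m using Nat.strong_induction_on with
  | _ m ih =>
    have hrem := uniformGrowth_remainder hu hM hK hB (h0 · m) fun l hl => (ih l hl).2
    have hform := uniformGrowth_form hu hM hA hK (h0 · m) (fun l hl => (ih l hl).2)
      fun l hl => (ih l hl).1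
    refine ⟨hrem, ?_⟩
    simpa only [ContinuousLinearMap.toSpanSingleton_apply, remainder_add_smul] using
      (hrem.mono (by omega : m / 2 ≤ (m + 1) / 2)).add (hform.map (.toSpanSingleton 𝕜 e))

end Growth

end General

section SecondMoment

variable [RCLike 𝕜] [NormedAddCommGroup E] [NormedSpace 𝕜 E] {A M X : E →L[𝕜] E} {e : E}
  {ℓ : E →L[𝕜] 𝕜} {u : ℕ → ℕ → E} {c : ℝ}

lemma neg_apply_sub_deflate (hX : X * (M - 1 + ℓ.smulRight e) = 1) {x : E} (hx : ℓ x = 0) :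
    (-X) (x - deflate M e ℓ x) = x := by
  simpa [deflate_apply, hx] using congr($hX x)

lemma IsFixedPair.map_inverse_apply (hM : IsFixedPair M e ℓ)
    (hX : (M - 1 + ℓ.smulRight e) * X = 1) {x : E} (hx : ℓ x = 0) : M (X x) = x + X x := by
  have hXx : M (X x) - X x + ℓ (X x) • e = x := by simpa using congr($hX x)
  have hℓ : ℓ (X x) = 0 := by simpa [hM.form_map, hM.form_vec, hx] using congr(ℓ $hXx)
  rw [hℓ, zero_smul, add_zero] at hXx
  exact sub_eq_iff_eq_add.1 hXx

namespace IsMomentSeq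

lemma form_zero (hu : IsMomentSeq A M u) (hM : IsFixedPair M e ℓ) (n : ℕ) :
    ℓ (u 0 n) = ℓ (u 0 0) := by
  induction n with
  | zero => rfl
  | succ n ih => simpa [hu.form_succ hM, momentForcing] using ih

lemma tendsto_cesaro_zero (hu : IsMomentSeq A M u) (hM : IsFixedPair M e ℓ)
    (hX : X * (M - 1 + ℓ.smulRight e) = 1) (hc : ∀ n, ‖remainder e ℓ (u 0 n)‖ ≤ c) :
    Tendsto (fun n : ℕ => (n : 𝕜)⁻¹ • ∑ j ∈ Finset.range n, u 0 j) atTop (𝓝 (ℓ (u 0 0) • e)) := by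
  have hrem : Tendsto (fun n : ℕ => (n : 𝕜)⁻¹ • ∑ j ∈ Finset.range n, remainder e ℓ (u 0 j)) atTop
      (𝓝 ((-X) 0)) :=
    tendsto_cesaro_of_affine_recursion (hu.remainder_succ hM 0)
      (fun n => neg_apply_sub_deflate hX (hM.form_remainder _)) hc (by simp [momentForcing])
  rw [map_zero] at hrem
  have hlim := hrem.add_const (ℓ (u 0 0) • e)
  rw [zero_add] at hlim
  refine hlim.congr' ?_
  filter_upwards [eventually_ne_atTop 0] with n hn
  have hn' : (n : 𝕜) ≠ 0 := Nat.cast_ne_zero.2 hn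
  simp only [remainder_apply, hu.form_zero hM, Finset.sum_sub_distrib, Finset.sum_const,
    Finset.card_range, ← Nat.cast_smul_eq_nsmul 𝕜, smul_sub, inv_smul_smul₀ hn', sub_add_cancel]

lemma tendsto_cesaro_remainder_one (hu : IsMomentSeq A M u) (hM : IsFixedPair M e ℓ)
    (hA : ℓ (A e) = 0) (hX : X * (M - 1 + ℓ.smulRight e) = 1) (h0 : ℓ (u 0 0) = 1)
    (hc0 : ∀ n, ‖remainder e ℓ (u 0 n)‖ ≤ c) (hc1 : ∀ n, ‖remainder e ℓ (u 1 n)‖ ≤ c) :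
    Tendsto (fun n : ℕ => (n : 𝕜)⁻¹ • ∑ j ∈ Finset.range n, remainder e ℓ (u 1 j)) atTop
      (𝓝 ((-X) (A e))) := by
  refine tendsto_cesaro_of_affine_recursion (hu.remainder_succ hM 1)
    (fun n => neg_apply_sub_deflate hX (hM.form_remainder _)) hc1 ?_
  have hlim := ((remainder e ℓ * A * M).continuous.tendsto _).comp
    (hu.tendsto_cesaro_zero hM hX hc0)
  simp only [h0, one_smul, mul_apply_eq_comp, hM.map_vec, remainder_apply (A e), hA, zero_smul,
    sub_zero] at hlim
  refine hlim.congr fun n => ?_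
  simp [momentForcing]

lemma form_two (hu : IsMomentSeq A M u) (hM : IsFixedPair M e ℓ) (hA : ℓ (A e) = 0) (n : ℕ) :
    ℓ (u 2 n) = ℓ (u 2 0) + (2 * ℓ (A (M (∑ j ∈ Finset.range n, remainder e ℓ (u 1 j)))) +
      ℓ ((A ^ 2) (M (∑ j ∈ Finset.range n, u 0 j)))) := by
  induction n with
  | zero => simp
  | succ n ih =>
    rw [hu.form_succ hM, ih, hM.form_momentForcing_succ hA]
    simp only [Finset.sum_range_one, Finset.sum_range_succ _ n, map_add, Nat.choose_self]
    push_cast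
    ring

/-- The Cesàro means of `u 0` and of the remainder of `u 1` converge to `e` and to `-X (A e)`, where
`X` is the inverse of `M - 1 + ℓ(·) e`. -/
theorem tendsto_form_two (hu : IsMomentSeq A M u) (hM : IsFixedPair M e ℓ)
    (hA : ℓ (A e) = 0) (hX : X * (M - 1 + ℓ.smulRight e) = 1)
    (hX' : (M - 1 + ℓ.smulRight e) * X = 1) (h0 : ℓ (u 0 0) = 1)
    (hc0 : ∀ n, ‖remainder e ℓ (u 0 n)‖ ≤ c) (hc1 : ∀ n, ‖remainder e ℓ (u 1 n)‖ ≤ c) :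
    Tendsto (fun n : ℕ => (n : 𝕜)⁻¹ * ℓ (u 2 n)) atTop
      (𝓝 (-ℓ ((A ^ 2) e) - 2 * ℓ (A (X (A e))))) := by
  have hone := ((ℓ.comp (A * M)).continuous.tendsto _).comp
    (hu.tendsto_cesaro_remainder_one hM hA hX h0 hc0 hc1)
  have hzero := ((ℓ.comp (A ^ 2 * M)).continuous.tendsto _).comp (hu.tendsto_cesaro_zero hM hX hc0)
  have hinit := (tendsto_inv_atTop_nhds_zero_nat (𝕜 := 𝕜)).mul_const (ℓ (u 2 0))
  have hlim := hinit.add ((hone.const_mul 2).add hzero)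
  have hval : 0 * ℓ (u 2 0) + (2 * (ℓ.comp (A * M)) ((-X) (A e)) +
      (ℓ.comp (A ^ 2 * M)) (ℓ (u 0 0) • e)) = -ℓ ((A ^ 2) e) - 2 * ℓ (A (X (A e))) := by
    simp [h0, hM.map_vec, hM.map_inverse_apply hX' hA, pow_two]
    ring
  rw [hval] at hlim
  refine hlim.congr fun n => ?_
  simp only [Function.comp_apply, ContinuousLinearMap.comp_apply, mul_apply_eq_comp, map_smul,
    smul_eq_mul, hu.form_two hM hA n]
  ring

end IsMomentSeq

end SecondMoment

end Moments

section PowerSums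

variable {R : Type*} [NormedRing R]

lemma exists_norm_pow_lt_one_of_spectralRadius_lt_one [NormedAlgebra ℂ R] [CompleteSpace R] {a : R}
    (ha : spectralRadius ℂ a < 1) : ∃ N : ℕ, ‖a ^ N‖ < 1 := by
  have hroot := (spectrum.pow_nnnorm_pow_one_div_tendsto_nhds_spectralRadius a).eventually
    (gt_mem_nhds ha)
  obtain ⟨N, hN, hN0⟩ := (hroot.and (eventually_gt_atTop 0)).exists
  refine ⟨N, ?_⟩
  by_contra! hone
  exact hN.not_ge (ENNReal.one_le_rpow (by exact_mod_cast hone) (by positivity))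

lemma exists_sum_norm_pow_le_of_isCompact {X : Type*} [TopologicalSpace X] {s : Set X}
    (hs : IsCompact s) {a : X → R} (ha : Continuous a) {K : ℝ} (hK : ∀ x j, ‖a x ^ j‖ ≤ K)
    (hpow : ∀ x, ∃ N : ℕ, ‖a x ^ N‖ < 1) :
    ∃ B : ℝ, ∀ x ∈ s, ∀ n, ∑ j ∈ Finset.range n, ‖a x ^ j‖ ≤ B := by
  refine hs.induction_on
    (p := fun t => ∃ B : ℝ, ∀ x ∈ t, ∀ n, ∑ j ∈ Finset.range n, ‖a x ^ j‖ ≤ B)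
    (by simp) ?mono ?union ?nhds
  case mono =>
    rintro t t' htt' ⟨B, hB⟩
    exact ⟨B, fun x hx => hB x (htt' hx)⟩
  case union =>
    rintro t t' ⟨B, hB⟩ ⟨B', hB'⟩
    refine ⟨max B B', fun x hx n => ?_⟩
    rcases hx with hx | hx
    · exact (hB x hx n).trans (le_max_left _ _)
    · exact (hB' x hx n).trans (le_max_right _ _)
  case nhds =>
    intro x _
    obtain ⟨N, hN⟩ := hpow x
    obtain ⟨q, hNq, hq⟩ := exists_between hN
    have hev : ∀ᶠ y in 𝓝 x, ‖a y ^ N‖ < q := ((ha.pow N).norm.tendsto x).eventually_lt_const hNq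
    exact ⟨_, mem_nhdsWithin_of_mem_nhds hev, N * K / (1 - q), fun y hy n =>
      sum_norm_pow_le (hK y) hq (le_of_lt hy) n⟩

end PowerSums

section SpectralRadius

variable {E : Type*} [NormedAddCommGroup E] [NormedSpace ℂ E] [FiniteDimensional ℂ E]

lemma spectralRadius_lt_one_of_forall_eigenvalue [Nontrivial E] {T : E →L[ℂ] E}
    (hT : ∀ (a : ℂ) (x : E), x ≠ 0 → T x = a • x → ‖a‖ < 1) : spectralRadius ℂ T < 1 := by
  have : CompleteSpace E := FiniteDimensional.complete ℂ E
  refine spectrum.spectralRadius_lt_of_forall_lt T fun a ha => ?_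
  rw [← AlgEquiv.spectrum_eq (Module.End.toContinuousLinearMap (𝕜 := ℂ) E).symm T,
    ← Module.End.hasEigenvalue_iff_mem_spectrum] at ha
  obtain ⟨x, hx⟩ := ha.exists_hasEigenvector
  exact hT a x hx.2 hx.apply_eq_smul

/-- An eigenvector of the deflated operator for an eigenvalue `a ≠ 0` lies in the kernel of `ℓ`,
where `deflate M e ℓ` and `M` agree. -/
lemma IsFixedPair.spectralRadius_deflate_lt_one [Nontrivial E] {M : E →L[ℂ] E} {e : E}
    {ℓ : E →L[ℂ] ℂ} (hM : IsFixedPair M e ℓ)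
    (hgap : ∀ (a : ℂ) (x : E), x ≠ 0 → ℓ x = 0 → M x = a • x → ‖a‖ < 1) :
    spectralRadius ℂ (deflate M e ℓ) < 1 := by
  refine spectralRadius_lt_one_of_forall_eigenvalue fun a x hx hax => ?_
  rcases eq_or_ne a 0 with rfl | ha
  · simp
  have hℓ : a * ℓ x = 0 := by
    rw [← smul_eq_mul, ← map_smul, ← hax, hM.form_deflate]
  have hℓx : ℓ x = 0 := (mul_eq_zero.1 hℓ).resolve_left ha
  refine hgap a x hx hℓx ?_
  rw [← hax, deflate_apply, hℓx, zero_smul, sub_zero]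

end SpectralRadius

section MeanOperator

section FixedPair

variable {𝕜 E : Type*}

lemma IsFixedPair.mul [NontriviallyNormedField 𝕜] [NormedAddCommGroup E] [NormedSpace 𝕜 E]
    {M N : E →L[𝕜] E} {e : E} {ℓ : E →L[𝕜] 𝕜} (hM : IsFixedPair M e ℓ) (hN : IsFixedPair N e ℓ) :
    IsFixedPair (M * N) e ℓ where
  map_vec := by rw [mul_apply_eq_comp, hN.map_vec, hM.map_vec]
  form_map x := by rw [mul_apply_eq_comp, hM.form_map, hN.form_map]
  form_vec := hM.form_vec

lemma IsFixedPair.of_integral [RCLike 𝕜] [NormedAddCommGroup E] [NormedSpace 𝕜 E]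
    [NormedSpace ℝ E] [CompleteSpace E] {Ω : Type*} [MeasurableSpace Ω] {μ : Measure Ω}
    [IsProbabilityMeasure μ] {M : Ω → E →L[𝕜] E} {N : E →L[𝕜] E} {e : E} {ℓ : E →L[𝕜] 𝕜}
    (hM : ∀ ω, IsFixedPair (M ω) e ℓ) (hint : ∀ x, Integrable (fun ω => M ω x) μ)
    (hN : ∀ x, N x = ∫ ω, M ω x ∂μ) : IsFixedPair N e ℓ where
  map_vec := by simp [hN, (hM _).map_vec]
  form_map x := by
    rw [hN, ← ℓ.integral_comp_comm (hint x)]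
    simp [(hM _).form_map]
  form_vec := by
    obtain ⟨ω⟩ := μ.nonempty_of_neZero
    exact (hM ω).form_vec

end FixedPair

section Matrices

variable {n : Type*}

/-- `U ⊗ Ū`, the matrix of the map `X ↦ U X U*` on `n × n` matrices `X`. -/
def tensorConj (U : Matrix n n ℂ) : Matrix (n × n) (n × n) ℂ := U ⊗ₖ U.map (starRingEnd ℂ)

lemma tensorConj_apply (U : Matrix n n ℂ) (S T : n × n) :
    tensorConj U S T = U S.1 T.1 * (starRingEnd ℂ) (U S.2 T.2) := rfl

variable [Fintype n] [DecidableEq n]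

lemma norm_toEuclideanCLM_of_unitary {U : Matrix n n ℂ} (hU : U ∈ unitary (Matrix n n ℂ))
    (x : EuclideanSpace ℂ n) : ‖Matrix.toEuclideanCLM (n := n) (𝕜 := ℂ) U x‖ = ‖x‖ :=
  ContinuousLinearMap.norm_map_of_mem_unitary (Unitary.map_mem _ hU) x

lemma tensorConj_mem_unitary {U : Matrix n n ℂ} (hU : U ∈ Matrix.unitaryGroup n ℂ) :
    tensorConj U ∈ unitary (Matrix (n × n) (n × n) ℂ) :=
  Matrix.kronecker_mem_unitary hU (Matrix.map_star_mem_unitaryGroup_iff.2 hU)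

lemma tensorConj_mulVec_vec_one {U : Matrix n n ℂ} (hU : U ∈ Matrix.unitaryGroup n ℂ) :
    (tensorConj U).mulVec (Matrix.vec 1) = Matrix.vec 1 := by
  rw [tensorConj, Matrix.kronecker_mulVec_vec, mul_one]
  congr 1
  rw [← Matrix.transpose_inj, Matrix.transpose_mul, Matrix.transpose_transpose,
    Matrix.transpose_one]
  exact Matrix.mem_unitaryGroup_iff.1 hU

lemma vec_one_vecMul_tensorConj {U : Matrix n n ℂ} (hU : U ∈ Matrix.unitaryGroup n ℂ) :
    Matrix.vecMul (Matrix.vec 1) (tensorConj U) = Matrix.vec 1 := by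
  rw [tensorConj, Matrix.vec_vecMul_kronecker, mul_one]
  congr 1
  exact Matrix.mem_unitaryGroup_iff'.1 hU

lemma exists_eq_smul_of_rootMultiplicity_charpoly_le_one {K : Type*} [Field K] {B : Matrix n n K}
    {a : K} (ha : B.charpoly.rootMultiplicity a ≤ 1) {x y : n → K} (hy : y ≠ 0)
    (hBx : B.mulVec x = a • x) (hBy : B.mulVec y = a • y) : ∃ c : K, x = c • y := by
  have hrank := (LinearMap.finrank_eigenspace_le (Matrix.toLin' B) a).trans
    ((Matrix.charpoly_toLin' B).symm ▸ ha)
  obtain ⟨w, hw⟩ := finrank_le_one_iff.1 hrank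
  have hmem {v : n → K} (hv : B.mulVec v = a • v) : v ∈ Module.End.eigenspace (Matrix.toLin' B) a :=
    Module.End.mem_eigenspace_iff.2 (by simpa using hv)
  obtain ⟨b, hb⟩ := hw ⟨x, hmem hBx⟩
  obtain ⟨c, hc⟩ := hw ⟨y, hmem hBy⟩
  have hbx : b • (w : n → K) = x := congrArg Subtype.val hb
  have hcy : c • (w : n → K) = y := congrArg Subtype.val hc
  have hc0 : c ≠ 0 := by
    rintro rfl
    exact hy (by rw [← hcy, zero_smul])
  exact ⟨b / c, by rw [← hcy, smul_smul, div_mul_cancel₀ b hc0, hbx]⟩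

end Matrices

variable {d : ℕ} {Ω : Type*} [MeasurableSpace Ω] {r : CoinIdx d → Fin d → ℤ} {μ : Measure Ω}
  {C : Ω → Matrix.unitaryGroup (CoinIdx d) ℂ}

/-- The space `ℂ^{2d} ⊗ ℂ^{2d}` on which `ℳ(-v,v)` acts. -/
abbrev TensorSpace (d : ℕ) : Type := EuclideanSpace ℂ (CoinIdx d × CoinIdx d)

/-- The linear form `x ↦ ⟨Ψ₁, x⟩`: the trace, if `x` is read as a `2d × 2d` matrix. -/
noncomputable def traceForm (d : ℕ) : TensorSpace d →L[ℂ] ℂ :=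
  ∑ τ : CoinIdx d, EuclideanSpace.proj (τ, τ)

/-- The vector `Ψ₁ / 2d`, whose trace is `1`. -/
noncomputable def meanVec (d : ℕ) : TensorSpace d := WithLp.toLp 2 ((2 * d : ℂ)⁻¹ • psiOne d)

/-- Entrywise measurability of the random coin. -/
def MeasurableCoin (C : Ω → Matrix.unitaryGroup (CoinIdx d) ℂ) : Prop :=
  ∀ σ τ, Measurable fun ω => (C ω : Matrix (CoinIdx d) (CoinIdx d) ℂ) σ τ

/-- `ℳ(-v,v)` as an operator on the Hilbert space `ℂ^{2d} ⊗ ℂ^{2d}`. -/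
noncomputable def meanOp (r : CoinIdx d → Fin d → ℤ) (μ : Measure Ω)
    (C : Ω → Matrix.unitaryGroup (CoinIdx d) ℂ) (v : Fin d → ℝ) :
    TensorSpace d →L[ℂ] TensorSpace d :=
  Matrix.toEuclideanCLM (n := CoinIdx d × CoinIdx d) (𝕜 := ℂ) (meanMat r μ C (-v) v)

lemma traceForm_apply (x : TensorSpace d) : traceForm d x = ∑ τ, x (τ, τ) := by
  simp [traceForm]

lemma psiOne_eq_vec_one : psiOne d = Matrix.vec 1 := by
  ext ⟨σ, τ⟩
  simp [psiOne, Matrix.vec, Matrix.one_apply, eq_comm]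

lemma sum_mul_psiOne (f : CoinIdx d × CoinIdx d → ℂ) : ∑ T, f T * psiOne d T = ∑ τ, f (τ, τ) := by
  simp [Fintype.sum_prod_type, psiOne]

lemma traceForm_eq_dotProduct (x : TensorSpace d) : traceForm d x = psiOne d ⬝ᵥ x.ofLp := by
  rw [dotProduct_comm, dotProduct, sum_mul_psiOne, traceForm_apply]

lemma traceForm_meanVec [NeZero d] : traceForm d (meanVec d) = 1 := by
  have hd : (d : ℂ) ≠ 0 := Nat.cast_ne_zero.2 (NeZero.ne d)
  have hcard : (Fintype.card (CoinIdx d) : ℂ) = 2 * d := by simp [mul_comm]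
  simp only [traceForm_apply, meanVec, Pi.smul_apply, psiOne, if_true, smul_eq_mul, mul_one,
    Finset.sum_const, Finset.card_univ, nsmul_eq_mul, hcard]
  field_simp

lemma isFixedPair_of_mulVec_vecMul [NeZero d] {B : Mat2 d} (hB : B.mulVec (psiOne d) = psiOne d)
    (hB' : Matrix.vecMul (psiOne d) B = psiOne d) :
    IsFixedPair (Matrix.toEuclideanCLM (n := CoinIdx d × CoinIdx d) (𝕜 := ℂ) B) (meanVec d)
      (traceForm d) where
  map_vec := by rw [meanVec, Matrix.toEuclideanCLM_toLp, Matrix.mulVec_smul, hB]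
  form_map x := by
    rw [traceForm_eq_dotProduct, Matrix.ofLp_toEuclideanCLM, Matrix.dotProduct_mulVec, hB',
      traceForm_eq_dotProduct]
  form_vec := traceForm_meanVec

lemma isFixedPair_tensorConj [NeZero d] (U : Matrix.unitaryGroup (CoinIdx d) ℂ) :
    IsFixedPair (Matrix.toEuclideanCLM (n := CoinIdx d × CoinIdx d) (𝕜 := ℂ)
      (tensorConj (U : Matrix (CoinIdx d) (CoinIdx d) ℂ))) (meanVec d) (traceForm d) :=
  isFixedPair_of_mulVec_vecMul
    (by simpa only [psiOne_eq_vec_one] using tensorConj_mulVec_vec_one U.2)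
    (by simpa only [psiOne_eq_vec_one] using vec_one_vecMul_tensorConj U.2)

lemma phaseMat_apply_self_mul_psiOne (r : CoinIdx d → Fin d → ℤ) (v : Fin d → ℝ)
    (T : CoinIdx d × CoinIdx d) : phaseMat r (-v) v T T * psiOne d T = psiOne d T := by
  obtain ⟨σ, τ⟩ := T
  rcases eq_or_ne σ τ with rfl | h
  · simp [phaseMat]
  · simp [psiOne, h]

lemma isFixedPair_phaseMat [NeZero d] (r : CoinIdx d → Fin d → ℤ) (v : Fin d → ℝ) :
    IsFixedPair (Matrix.toEuclideanCLM (n := CoinIdx d × CoinIdx d) (𝕜 := ℂ) (phaseMat r (-v) v))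
      (meanVec d) (traceForm d) := by
  refine isFixedPair_of_mulVec_vecMul ?_ ?_
  · ext T
    rw [← phaseMat_apply_self_mul_psiOne r v T, phaseMat, Matrix.mulVec_diagonal,
      Matrix.diagonal_apply_eq]
  · ext T
    rw [← phaseMat_apply_self_mul_psiOne r v T, phaseMat, Matrix.vecMul_diagonal,
      Matrix.diagonal_apply_eq, mul_comm]

lemma phaseMat_mem_unitary (r : CoinIdx d → Fin d → ℤ) (y y' : Fin d → ℝ) :
    phaseMat r y y' ∈ unitary (Mat2 d) := by
  refine Matrix.mem_unitaryGroup_iff'.2 ?_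
  rw [phaseMat, Matrix.star_eq_conjTranspose, Matrix.diagonal_conjTranspose,
    Matrix.diagonal_mul_diagonal, ← Matrix.diagonal_one]
  congr 1
  funext T
  rw [Pi.star_apply, RCLike.star_def, ← Complex.exp_conj, ← Complex.exp_add]
  simp [Complex.conj_ofReal]

lemma measurable_tensorConj (hC : MeasurableCoin C) (S T : CoinIdx d × CoinIdx d) :
    Measurable fun ω => tensorConj (C ω : Matrix (CoinIdx d) (CoinIdx d) ℂ) S T := by
  simp only [tensorConj_apply]
  exact (hC _ _).mul (Complex.continuous_conj.measurable.comp (hC _ _))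

lemma norm_tensorConj_apply_le (U : Matrix.unitaryGroup (CoinIdx d) ℂ)
    (S T : CoinIdx d × CoinIdx d) :
    ‖tensorConj (U : Matrix (CoinIdx d) (CoinIdx d) ℂ) S T‖ ≤ 1 :=
  entry_norm_bound_of_unitary (tensorConj_mem_unitary U.2) S T

lemma integrable_tensorConj [IsFiniteMeasure μ] (hC : MeasurableCoin C)
    (S T : CoinIdx d × CoinIdx d) :
    Integrable (fun ω => tensorConj (C ω : Matrix (CoinIdx d) (CoinIdx d) ℂ) S T) μ :=
  .of_bound (measurable_tensorConj hC S T).aestronglyMeasurable 1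
    (ae_of_all _ fun ω => norm_tensorConj_apply_le (C ω) S T)

lemma toEuclideanCLM_apply_apply (B : Mat2 d) (x : TensorSpace d) (S : CoinIdx d × CoinIdx d) :
    Matrix.toEuclideanCLM (n := CoinIdx d × CoinIdx d) (𝕜 := ℂ) B x S = ∑ T, B S T * x T := rfl

lemma integrable_tensorConj_apply [IsFiniteMeasure μ] (hC : MeasurableCoin C) (x : TensorSpace d) :
    Integrable (fun ω => Matrix.toEuclideanCLM (n := CoinIdx d × CoinIdx d) (𝕜 := ℂ)
      (tensorConj (C ω : Matrix (CoinIdx d) (CoinIdx d) ℂ)) x) μ := by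
  refine .of_eval_piLp fun S => ?_
  simp only [toEuclideanCLM_apply_apply]
  exact integrable_finsetSum _ fun T _ => (integrable_tensorConj hC S T).mul_const _

lemma meanTensor_apply_eq_integral [IsFiniteMeasure μ] (hC : MeasurableCoin C)
    (x : TensorSpace d) :
    Matrix.toEuclideanCLM (n := CoinIdx d × CoinIdx d) (𝕜 := ℂ) (meanTensor μ C) x =
      ∫ ω, Matrix.toEuclideanCLM (n := CoinIdx d × CoinIdx d) (𝕜 := ℂ)
        (tensorConj (C ω : Matrix (CoinIdx d) (CoinIdx d) ℂ)) x ∂μ := by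
  ext S
  rw [eval_integral_piLp fun S => (integrable_tensorConj_apply hC x).eval_piLp S]
  simp only [toEuclideanCLM_apply_apply]
  rw [integral_finsetSum _ fun T _ => (integrable_tensorConj hC S T).mul_const _]
  simp only [integral_mul_const]
  rfl

lemma isFixedPair_meanOp [NeZero d] [IsProbabilityMeasure μ] (hC : MeasurableCoin C)
    (v : Fin d → ℝ) : IsFixedPair (meanOp r μ C v) (meanVec d) (traceForm d) := by
  rw [meanOp, meanMat, map_mul]
  exact (isFixedPair_phaseMat r v).mul (.of_integral (fun ω => isFixedPair_tensorConj (C ω))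
    (integrable_tensorConj_apply hC) (meanTensor_apply_eq_integral hC))

lemma norm_meanOp_le_one [IsProbabilityMeasure μ] (hC : MeasurableCoin C) (v : Fin d → ℝ) :
    ‖meanOp r μ C v‖ ≤ 1 := by
  refine ContinuousLinearMap.opNorm_le_bound _ zero_le_one fun x => ?_
  rw [meanOp, meanMat, map_mul, mul_apply_eq_comp, one_mul,
    norm_toEuclideanCLM_of_unitary (phaseMat_mem_unitary _ _ _), meanTensor_apply_eq_integral hC]
  refine (norm_integral_le_integral_norm _).trans ?_
  simp [fun ω => norm_toEuclideanCLM_of_unitary (tensorConj_mem_unitary (C ω).2)]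

lemma AssumptionS.exists_eq_smul_meanVec [NeZero d] [IsProbabilityMeasure μ]
    (hS : AssumptionS r μ C) (hC : MeasurableCoin C) {v : Fin d → ℝ} {x : TensorSpace d}
    (hx : meanOp r μ C v x = x) : ∃ c : ℂ, x = c • meanVec d := by
  have hM := isFixedPair_meanOp (r := r) (μ := μ) hC v
  have hne : (meanVec d).ofLp ≠ 0 := fun h0 => by
    simpa [traceForm_apply, h0] using traceForm_meanVec (d := d)
  obtain ⟨c, hc⟩ := exists_eq_smul_of_rootMultiplicity_charpoly_le_one (hS v).2.le (x := x.ofLp) hne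
    (by simpa [meanOp] using congr(WithLp.ofLp $hx))
    (by simpa [meanOp] using congr(WithLp.ofLp $(hM.map_vec)))
  exact ⟨c, PiLp.ext (congrFun hc)⟩

lemma AssumptionS.norm_eigenvalue_lt_one [NeZero d] [IsProbabilityMeasure μ]
    (hS : AssumptionS r μ C) (hC : MeasurableCoin C) (v : Fin d → ℝ) (a : ℂ) (x : TensorSpace d)
    (hx : x ≠ 0) (hℓ : traceForm d x = 0) (hax : meanOp r μ C v x = a • x) : ‖a‖ < 1 := by
  have hle : ‖a‖ ≤ 1 := by
    have h := (meanOp r μ C v).le_of_opNorm_le (norm_meanOp_le_one hC v) x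
    rw [hax, norm_smul] at h
    exact le_of_mul_le_mul_right h (norm_pos_iff.2 hx)
  refine hle.lt_of_ne fun ha => ?_
  have hspec : a ∈ spectrum ℂ (meanMat r μ C (-v) v) := by
    rw [← Matrix.spectrum_toLin', ← Module.End.hasEigenvalue_iff_mem_spectrum]
    refine Module.End.hasEigenvalue_of_hasEigenvector (x := x.ofLp)
      ⟨Module.End.mem_eigenspace_iff.2 ?_, by simpa using hx⟩
    simpa [meanOp] using congr(WithLp.ofLp $hax)
  have ha1 : a ∈ ({1} : Set ℂ) := (hS v).1 ▸ ⟨hspec, by simpa using ha⟩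
  rw [Set.mem_singleton_iff.1 ha1, one_smul] at hax
  obtain ⟨c, rfl⟩ := hS.exists_eq_smul_meanVec hC hax
  have hc : c = 0 := by simpa [traceForm_meanVec] using hℓ
  exact hx (by rw [hc, zero_smul])

lemma continuous_meanMat : Continuous fun v : Fin d → ℝ => meanMat r μ C (-v) v := by
  refine (Continuous.matrix_diagonal (continuous_pi fun T => ?_)).matrix_mul continuous_const
  simp only [Pi.neg_apply]
  fun_prop

lemma continuous_meanOp : Continuous (meanOp r μ C) :=
  (LinearMap.continuous_of_finiteDimensional
    (Matrix.toEuclideanCLM (n := CoinIdx d × CoinIdx d) (𝕜 := ℂ)).toAlgEquiv.toLinearMap).comp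
    continuous_meanMat

lemma AssumptionS.exists_sum_norm_deflate_pow_le [NeZero d] [IsProbabilityMeasure μ]
    (hS : AssumptionS r μ C) (hC : MeasurableCoin C) {s : Set (Fin d → ℝ)} (hs : IsCompact s) :
    ∃ B : ℝ, ∀ v ∈ s, ∀ n,
      ∑ j ∈ Finset.range n, ‖deflate (meanOp r μ C v) (meanVec d) (traceForm d) ^ j‖ ≤ B := by
  have hcont : Continuous fun v => deflate (meanOp r μ C v) (meanVec d) (traceForm d) :=
    continuous_meanOp.sub continuous_const
  refine exists_sum_norm_pow_le_of_isCompact hs hcont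
    (fun v => (isFixedPair_meanOp hC v).norm_deflate_pow_le (norm_meanOp_le_one hC v)) fun v => ?_
  exact exists_norm_pow_lt_one_of_spectralRadius_lt_one
    ((isFixedPair_meanOp hC v).spectralRadius_deflate_lt_one (hS.norm_eigenvalue_lt_one hC v))

end MeanOperator

section Resolvent

section Inverse

variable {𝕜 E : Type*} [NontriviallyNormedField 𝕜] [NormedAddCommGroup E] [NormedSpace 𝕜 E]
  {M X : E →L[𝕜] E} {e : E} {ℓ : E →L[𝕜] 𝕜}

lemma IsFixedPair.inverse (hM : IsFixedPair M e ℓ) (hX : X * (M - 1 + ℓ.smulRight e) = 1)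
    (hX' : (M - 1 + ℓ.smulRight e) * X = 1) : IsFixedPair X e ℓ where
  map_vec := by simpa [hM.map_vec, hM.form_vec] using congr($hX e)
  form_map x := by simpa [hM.form_map, hM.form_vec] using congr(ℓ ($hX' x))
  form_vec := hM.form_vec

lemma IsFixedPair.centred_quadratic (hX : IsFixedPair X e ℓ) (B : E →L[𝕜] E) :
    -ℓ (((B - ℓ (B e) • 1 : E →L[𝕜] E) ^ 2) e)
        - 2 * ℓ ((B - ℓ (B e) • 1) (X ((B - ℓ (B e) • 1) e))) =
      ℓ (B e) ^ 2 - ℓ ((B ^ 2) e) - 2 * ℓ (B (deflate X e ℓ (B e))) := by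
  simp [pow_two, deflate_apply, hX.map_vec, hX.form_map, hX.form_vec]

end Inverse

variable {d : ℕ} {Ω : Type*} [MeasurableSpace Ω] {r : CoinIdx d → Fin d → ℤ} {μ : Measure Ω}
  {C : Ω → Matrix.unitaryGroup (CoinIdx d) ℂ}

lemma sum_mul_meanVec (f : CoinIdx d × CoinIdx d → ℂ) :
    ∑ T, f T * meanVec d T = (2 * d : ℂ)⁻¹ * ∑ τ, f (τ, τ) := by
  rw [← sum_mul_psiOne, Finset.mul_sum]
  exact Finset.sum_congr rfl fun T _ => mul_left_comm _ _ _

lemma toEuclideanCLM_projP :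
    Matrix.toEuclideanCLM (n := CoinIdx d × CoinIdx d) (𝕜 := ℂ) (projP d) =
      (traceForm d).smulRight (meanVec d) := by
  have hstar : star (psiOne d) = psiOne d := by
    ext T
    simp [psiOne, apply_ite]
  ext x S
  simp [projP, hstar, Matrix.vecMulVec_mulVec, traceForm_eq_dotProduct,
    meanVec, mul_comm, mul_left_comm]

/-- The matrix `ℳ(-v,v) - Q`, whose inverse is `P + S_v(1)`. -/
noncomputable def shiftedMat (r : CoinIdx d → Fin d → ℤ) (μ : Measure Ω)
    (C : Ω → Matrix.unitaryGroup (CoinIdx d) ℂ) (v : Fin d → ℝ) : Mat2 d :=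
  meanMat r μ C (-v) v - (1 - projP d)

/-- `P + S_v(1)`, the inverse of `ℳ(-v,v) - Q`, as an operator. -/
noncomputable def shiftedInv (r : CoinIdx d → Fin d → ℤ) (μ : Measure Ω)
    (C : Ω → Matrix.unitaryGroup (CoinIdx d) ℂ) (v : Fin d → ℝ) :
    TensorSpace d →L[ℂ] TensorSpace d :=
  Matrix.toEuclideanCLM (n := CoinIdx d × CoinIdx d) (𝕜 := ℂ) (shiftedMat r μ C v)⁻¹

lemma toEuclideanCLM_shiftedMat (v : Fin d → ℝ) :
    Matrix.toEuclideanCLM (n := CoinIdx d × CoinIdx d) (𝕜 := ℂ) (shiftedMat r μ C v) =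
      meanOp r μ C v - 1 + (traceForm d).smulRight (meanVec d) := by
  rw [shiftedMat, map_sub, map_sub, map_one, toEuclideanCLM_projP, meanOp, sub_sub_eq_add_sub,
    sub_add_eq_add_sub]

lemma deflate_shiftedInv (v : Fin d → ℝ) :
    deflate (shiftedInv r μ C v) (meanVec d) (traceForm d) =
      Matrix.toEuclideanCLM (n := CoinIdx d × CoinIdx d) (𝕜 := ℂ) (reducedResolvent r μ C v) := by
  rw [reducedResolvent, map_sub, toEuclideanCLM_projP]
  rfl

section Gap

variable [NeZero d] [IsProbabilityMeasure μ]

lemma AssumptionS.det_shiftedMat_ne_zero (hS : AssumptionS r μ C) (hC : MeasurableCoin C)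
    (v : Fin d → ℝ) : (shiftedMat r μ C v).det ≠ 0 := by
  intro hdet
  obtain ⟨y, hy, hSy⟩ := Matrix.exists_mulVec_eq_zero_iff.2 hdet
  have hM := isFixedPair_meanOp (r := r) (μ := μ) hC v
  have hker : meanOp r μ C v (.toLp 2 y) - .toLp 2 y + traceForm d (.toLp 2 y) • meanVec d = 0 := by
    have h := congr($(toEuclideanCLM_shiftedMat (r := r) (μ := μ) (C := C) v) (.toLp 2 y))
    rw [Matrix.toEuclideanCLM_toLp, hSy] at h
    simpa using h.symm
  have hℓ : traceForm d (.toLp 2 y) = 0 := by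
    simpa [hM.form_map, hM.form_vec] using congr(traceForm d $hker)
  rw [hℓ, zero_smul, add_zero, sub_eq_zero] at hker
  have hlt := hS.norm_eigenvalue_lt_one hC v 1 (.toLp 2 y) (by simpa using hy) hℓ (by simpa)
  simp at hlt

lemma AssumptionS.shiftedInv_mul (hS : AssumptionS r μ C) (hC : MeasurableCoin C) (v : Fin d → ℝ) :
    shiftedInv r μ C v * (meanOp r μ C v - 1 + (traceForm d).smulRight (meanVec d)) = 1 := by
  rw [← toEuclideanCLM_shiftedMat, shiftedInv, ← map_mul,
    Matrix.nonsing_inv_mul _ (hS.det_shiftedMat_ne_zero hC v).isUnit, map_one]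

lemma AssumptionS.mul_shiftedInv (hS : AssumptionS r μ C) (hC : MeasurableCoin C) (v : Fin d → ℝ) :
    (meanOp r μ C v - 1 + (traceForm d).smulRight (meanVec d)) * shiftedInv r μ C v = 1 := by
  rw [← toEuclideanCLM_shiftedMat, shiftedInv, ← map_mul,
    Matrix.mul_nonsing_inv _ (hS.det_shiftedMat_ne_zero hC v).isUnit, map_one]

lemma AssumptionS.continuous_diffusionAt (hS : AssumptionS r μ C) (hC : MeasurableCoin C)
    (i j : Fin d) : Continuous fun v => diffusionAt r μ C v i j := by
  have hmat : Continuous fun v : Fin d → ℝ => shiftedMat r μ C v :=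
    continuous_meanMat.sub continuous_const
  have hinv : Continuous fun v : Fin d → ℝ => (shiftedMat r μ C v)⁻¹ := by
    simp only [Matrix.inv_def, Ring.inverse_eq_inv']
    exact (hmat.matrix_det.inv₀ (hS.det_shiftedMat_ne_zero hC)).smul hmat.matrix_adjugate
  have hres (S T) : Continuous fun v : Fin d → ℝ => reducedResolvent r μ C v S T :=
    (hinv.sub continuous_const).matrix_elem S T
  unfold diffusionAt
  fun_prop

end Gap

/-- Multiplication by a function of the first label of `|τ ⊗ τ'⟩`. -/
noncomputable def firstMul (b : CoinIdx d → ℂ) : TensorSpace d →L[ℂ] TensorSpace d :=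
  Matrix.toEuclideanCLM (n := CoinIdx d × CoinIdx d) (𝕜 := ℂ) (.diagonal fun T => b T.1)

lemma firstMul_apply (b : CoinIdx d → ℂ) (x : TensorSpace d) (T : CoinIdx d × CoinIdx d) :
    firstMul b x T = b T.1 * x T := by
  simp [firstMul, Matrix.mulVec_diagonal]

lemma firstMul_pow (b : CoinIdx d → ℂ) (j : ℕ) : firstMul b ^ j = firstMul (b ^ j) := by
  rw [firstMul, ← map_pow, Matrix.diagonal_pow]
  rfl

lemma firstMul_sub_const (b : CoinIdx d → ℂ) (c : ℂ) :
    firstMul (fun τ => b τ - c) = firstMul b - c • 1 := by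
  ext x T
  simp [firstMul_apply, sub_mul]

lemma traceForm_firstMul_meanVec (b : CoinIdx d → ℂ) :
    traceForm d (firstMul b (meanVec d)) = (2 * d : ℂ)⁻¹ * ∑ τ, b τ := by
  simp [traceForm_apply, firstMul_apply, meanVec, psiOne, mul_comm]

lemma traceForm_firstMul_toEuclideanCLM_firstMul (b : CoinIdx d → ℂ) (B : Mat2 d) :
    traceForm d (firstMul b (Matrix.toEuclideanCLM (n := CoinIdx d × CoinIdx d) (𝕜 := ℂ) B
      (firstMul b (meanVec d)))) =
      (2 * d : ℂ)⁻¹ * ∑ τ, ∑ τ', b τ * b τ' * B (τ, τ) (τ', τ') := by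
  simp only [traceForm_apply, firstMul_apply, toEuclideanCLM_apply_apply, ← mul_assoc,
    sum_mul_meanVec, Finset.mul_sum]
  exact Finset.sum_congr rfl fun τ _ => Finset.sum_congr rfl fun τ' _ => by ring

/-- The component `z · (x - n r̄)` of the centred position. -/
noncomputable def displacement (r : CoinIdx d → Fin d → ℤ) (z : Fin d → ℝ) (n : ℕ)
    (x : Fin d → ℤ) : ℝ :=
  z ⬝ᵥ fun i => (x i - n * meanJump r i : ℝ)

/-- Multiplication by the component along `z` of the centred jump of the first label: the
infinitesimal translation of the moments of the walk. -/
noncomputable def jumpOp (r : CoinIdx d → Fin d → ℤ) (z : Fin d → ℝ) :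
    TensorSpace d →L[ℂ] TensorSpace d :=
  firstMul fun τ => (displacement r z 1 (r τ) : ℂ)

/-- The component `z · r(τ)` of a jump. -/
noncomputable def jump (r : CoinIdx d → Fin d → ℤ) (z : Fin d → ℝ) (τ : CoinIdx d) : ℂ :=
  ∑ i, (z i : ℂ) * r τ i

lemma mean_jump (r : CoinIdx d → Fin d → ℤ) (z : Fin d → ℝ) :
    (2 * d : ℂ)⁻¹ * ∑ τ, jump r z τ = ∑ i, (z i : ℂ) * meanJump r i := by
  simp only [jump, meanJump]
  push_cast
  rw [Finset.sum_comm, Finset.mul_sum]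
  exact Finset.sum_congr rfl fun i _ => by rw [← Finset.mul_sum, mul_left_comm]

lemma jumpOp_eq_sub (r : CoinIdx d → Fin d → ℤ) (z : Fin d → ℝ) :
    jumpOp r z = firstMul (jump r z) - traceForm d (firstMul (jump r z) (meanVec d)) • 1 := by
  rw [← firstMul_sub_const, traceForm_firstMul_meanVec, mean_jump, jumpOp]
  congr 1
  ext τ
  simp [displacement, jump, dotProduct, mul_sub]

lemma traceForm_jumpOp_meanVec [NeZero d] (z : Fin d → ℝ) :
    traceForm d (jumpOp r z (meanVec d)) = 0 := by
  simp [jumpOp_eq_sub, traceForm_meanVec]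

section QuadraticForm

variable {R m : Type*} [Fintype m] [CommRing R]

lemma sum_sum_eq_dotProduct_mulVec (B : Matrix m m R) (a : m → R) :
    ∑ i, ∑ j, a i * B i j * a j = a ⬝ᵥ B.mulVec a := by
  simp only [dotProduct, Matrix.mulVec, Finset.mul_sum, mul_assoc]

lemma dotProduct_vecMulVec_mulVec (a b c : m → R) :
    a ⬝ᵥ (Matrix.vecMulVec b c).mulVec a = (a ⬝ᵥ b) * (a ⬝ᵥ c) := by
  rw [Matrix.vecMulVec_mulVec, dotProduct_comm c]
  simp [mul_comm]

end QuadraticForm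

lemma diffusionAt_eq_sum_vecMulVec (v : Fin d → ℝ) :
    diffusionAt r μ C v =
      Matrix.vecMulVec (fun i => (meanJump r i : ℂ)) (fun i => (meanJump r i : ℂ))
      - (2 * d : ℂ)⁻¹ • ∑ τ, Matrix.vecMulVec (fun i => (r τ i : ℂ)) (fun i => (r τ i : ℂ))
      - (2 * d : ℂ)⁻¹ • ∑ τ, ∑ τ', reducedResolvent r μ C v (τ, τ) (τ', τ') •
        (Matrix.vecMulVec (fun i => (r τ i : ℂ)) (fun i => (r τ' i : ℂ)) +
          Matrix.vecMulVec (fun i => (r τ' i : ℂ)) (fun i => (r τ i : ℂ))) := by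
  ext i j
  simp only [diffusionAt, Matrix.sub_apply, Matrix.smul_apply, Matrix.sum_apply,
    Matrix.add_apply, Matrix.vecMulVec_apply, smul_eq_mul]
  congr 2
  exact Finset.sum_congr rfl fun τ _ => Finset.sum_congr rfl fun τ' _ => by ring

lemma sum_sum_diffusionAt (v z : Fin d → ℝ) :
    ∑ i, ∑ j, (z i : ℂ) * diffusionAt r μ C v i j * (z j : ℂ) =
      (∑ i, (z i : ℂ) * meanJump r i) ^ 2 - (2 * d : ℂ)⁻¹ * ∑ τ, jump r z τ ^ 2
        - 2 * ((2 * d : ℂ)⁻¹ * ∑ τ, ∑ τ', jump r z τ * jump r z τ' *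
          reducedResolvent r μ C v (τ, τ) (τ', τ')) := by
  rw [sum_sum_eq_dotProduct_mulVec, diffusionAt_eq_sum_vecMulVec]
  simp only [Matrix.sub_mulVec, Matrix.smul_mulVec, Matrix.sum_mulVec, Matrix.add_mulVec,
    dotProduct_sub, dotProduct_smul, dotProduct_sum, dotProduct_add, dotProduct_vecMulVec_mulVec,
    smul_eq_mul]
  simp only [dotProduct, jump, pow_two, mul_left_comm (2 : ℂ), Finset.mul_sum (a := (2 : ℂ))]
  congr 2
  exact Finset.sum_congr rfl fun τ _ => Finset.sum_congr rfl fun τ' _ => by ring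

lemma AssumptionS.limit_eq_sum_diffusionAt [NeZero d] [IsProbabilityMeasure μ]
    (hS : AssumptionS r μ C) (hC : MeasurableCoin C) (v z : Fin d → ℝ) :
    -traceForm d ((jumpOp r z ^ 2) (meanVec d))
        - 2 * traceForm d (jumpOp r z (shiftedInv r μ C v (jumpOp r z (meanVec d)))) =
      ∑ i, ∑ j, (z i : ℂ) * diffusionAt r μ C v i j * (z j : ℂ) := by
  have hX := (isFixedPair_meanOp (r := r) (μ := μ) hC v).inverse (hS.shiftedInv_mul hC v)
    (hS.mul_shiftedInv hC v)
  rw [jumpOp_eq_sub, hX.centred_quadratic, deflate_shiftedInv, firstMul_pow,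
    traceForm_firstMul_toEuclideanCLM_firstMul, traceForm_firstMul_meanVec,
    traceForm_firstMul_meanVec, mean_jump, sum_sum_diffusionAt]
  rfl

end Resolvent


section Evolution

variable {d : ℕ} {r : CoinIdx d → Fin d → ℤ} {A : ℕ → Matrix (CoinIdx d) (CoinIdx d) ℂ}
  {φ : CoinSpace d}

lemma step_apply (U : Matrix (CoinIdx d) (CoinIdx d) ℂ) (ψ : WaveFun d) (x : Fin d → ℤ)
    (τ : CoinIdx d) : step r U ψ x τ = U.mulVec (ψ (x - r τ)) τ := by
  simp only [step, WithLp.ofLp_sum, Finset.sum_apply, EuclideanSpace.single]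
  rw [Finset.sum_eq_single τ (fun σ _ hσ => by simp [hσ.symm]) (by simp)]
  simp

lemma hasSum_norm_sq_step {U : Matrix (CoinIdx d) (CoinIdx d) ℂ}
    (hU : U ∈ Matrix.unitaryGroup (CoinIdx d) ℂ) {ψ : WaveFun d} {a : ℝ}
    (hψ : HasSum (fun x => ‖ψ x‖ ^ 2) a) : HasSum (fun x => ‖step r U ψ x‖ ^ 2) a := by
  set g : CoinIdx d → (Fin d → ℤ) → ℝ := fun τ x => ‖U.mulVec (ψ x) τ‖ ^ 2 with hg
  have hsum (x) : ∑ τ, g τ x = ‖ψ x‖ ^ 2 := by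
    rw [← norm_toEuclideanCLM_of_unitary hU (ψ x), EuclideanSpace.norm_sq_eq]
    rfl
  have hstep (x) : ‖step r U ψ x‖ ^ 2 = ∑ τ, g τ (x - r τ) := by
    simp only [EuclideanSpace.norm_sq_eq, step_apply, hg]
  have hsummable (τ) : Summable (g τ) := by
    refine hψ.summable.of_nonneg_of_le (fun x => sq_nonneg _) fun x => ?_
    rw [← hsum]
    exact Finset.single_le_sum (f := (g · x)) (fun σ _ => sq_nonneg _) (Finset.mem_univ τ)
  have hshift := hasSum_sum fun τ (_ : τ ∈ Finset.univ) =>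
    (Equiv.subRight (r τ)).hasSum_iff.2 (hsummable τ).hasSum
  have htotal := hasSum_sum fun τ (_ : τ ∈ Finset.univ) => (hsummable τ).hasSum
  simp only [hsum] at htotal
  simpa only [hstep, hψ.unique htotal, Function.comp_def, Equiv.subRight_apply] using hshift

lemma hasSum_posProb (hA : ∀ n, A n ∈ Matrix.unitaryGroup (CoinIdx d) ℂ) (hφ : ‖φ‖ = 1) (n : ℕ) :
    HasSum (posProb r A φ n) 1 := by
  induction n with
  | zero =>
    convert hasSum_ite_eq (0 : Fin d → ℤ) (1 : ℝ) using 2 with x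
    by_cases hx : x = 0 <;> simp [posProb, evolve, localized, hx, hφ]
  | succ n ih => exact hasSum_norm_sq_step (hA n) ih

lemma norm_evolve_apply_le (hA : ∀ n, A n ∈ Matrix.unitaryGroup (CoinIdx d) ℂ) (hφ : ‖φ‖ = 1)
    (n : ℕ) (x : Fin d → ℤ) (τ : CoinIdx d) : ‖evolve r A (localized φ) n x τ‖ ≤ 1 := by
  have hsq : ‖evolve r A (localized φ) n x‖ ^ 2 ≤ 1 :=
    le_hasSum (hasSum_posProb (r := r) hA hφ n) x fun y _ => sq_nonneg _
  exact (PiLp.norm_apply_le _ τ).trans ((sq_le_one_iff₀ (norm_nonneg _)).1 hsq)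

/-- The sites that the walk can reach from the origin in `n` steps, whatever the coins. -/
def reach (r : CoinIdx d → Fin d → ℤ) : ℕ → Finset (Fin d → ℤ)
  | 0 => {0}
  | n + 1 => (reach r n ×ˢ Finset.univ).image fun p => p.1 + r p.2

lemma evolve_eq_zero_of_notMem_reach {n : ℕ} {x : Fin d → ℤ} (hx : x ∉ reach r n) :
    evolve r A (localized φ) n x = 0 := by
  induction n generalizing x with
  | zero =>
    have hx0 : x ≠ 0 := by simpa [reach] using hx
    simp [evolve, localized, hx0]
  | succ n ih =>
    ext τ
    have hτ : x - r τ ∉ reach r n := fun h =>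
      hx (Finset.mem_image.2 ⟨(x - r τ, τ), by simpa using h, by simp⟩)
    simp [evolve, step_apply, ih hτ]

lemma posProb_eq_zero_of_notMem_reach {n : ℕ} {x : Fin d → ℤ} (hx : x ∉ reach r n) :
    posProb r A φ n x = 0 := by
  simp [posProb, evolve_eq_zero_of_notMem_reach hx]

/-- The entries of `ψ_n ⊗ \overline{ψ_n}`, where `ψ_n` is the state at time `n`. -/
noncomputable def correlation (r : CoinIdx d → Fin d → ℤ)
    (A : ℕ → Matrix (CoinIdx d) (CoinIdx d) ℂ) (φ : CoinSpace d) (n : ℕ)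
    (p : (Fin d → ℤ) × (Fin d → ℤ)) (T : CoinIdx d × CoinIdx d) : ℂ :=
  evolve r A (localized φ) n p.1 T.1 * (starRingEnd ℂ) (evolve r A (localized φ) n p.2 T.2)

lemma correlation_succ (n : ℕ) (p : (Fin d → ℤ) × (Fin d → ℤ)) (S : CoinIdx d × CoinIdx d) :
    correlation r A φ (n + 1) p S =
      ∑ T, tensorConj (A n) S T * correlation r A φ n (p - (r S.1, r S.2)) T := by
  rw [Fintype.sum_prod_type]
  simp only [correlation, evolve, step_apply, Matrix.mulVec, dotProduct, map_sum,
    Finset.sum_mul_sum, tensorConj_apply, map_mul, Prod.fst_sub, Prod.snd_sub]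
  exact Finset.sum_congr rfl fun σ _ => Finset.sum_congr rfl fun σ' _ => by ring

lemma correlation_eq_zero {n : ℕ} {p : (Fin d → ℤ) × (Fin d → ℤ)}
    (hp : p ∉ reach r n ×ˢ reach r n) (T : CoinIdx d × CoinIdx d) :
    correlation r A φ n p T = 0 := by
  rw [Finset.mem_product, not_and_or] at hp
  rcases hp with hp | hp <;> simp [correlation, evolve_eq_zero_of_notMem_reach hp]

lemma norm_correlation_le (hA : ∀ n, A n ∈ Matrix.unitaryGroup (CoinIdx d) ℂ) (hφ : ‖φ‖ = 1)
    (n : ℕ) (p : (Fin d → ℤ) × (Fin d → ℤ)) (T : CoinIdx d × CoinIdx d) :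
    ‖correlation r A φ n p T‖ ≤ 1 := by
  rw [correlation, norm_mul, RCLike.norm_conj]
  exact mul_le_one₀ (norm_evolve_apply_le hA hφ _ _ _) (norm_nonneg _)
    (norm_evolve_apply_le hA hφ _ _ _)

lemma sum_correlation_self (n : ℕ) (x : Fin d → ℤ) :
    ∑ τ, correlation r A φ n (x, x) (τ, τ) = posProb r A φ n x := by
  simp [correlation, posProb, EuclideanSpace.norm_sq_eq, Complex.mul_conj,
    Complex.normSq_eq_norm_sq]

end Evolution

section TwoPoint

section Past

variable {Ω : Type*} [MeasurableSpace Ω] {μ : Measure Ω}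

/-- The law of a sequence of independent environments with law `μ`. -/
noncomputable abbrev iidLaw (μ : Measure Ω) : Measure (ℕ → Ω) := Measure.infinitePi fun _ : ℕ => μ

/-- The σ-algebra generated by the first `n` coordinates. -/
abbrev pastAlgebra (Ω : Type*) [MeasurableSpace Ω] (n : ℕ) : MeasurableSpace (ℕ → Ω) :=
  ⨆ i ∈ Set.Iio n, MeasurableSpace.comap (fun ω : ℕ → Ω => ω i) inferInstance

lemma pastAlgebra_le (n : ℕ) : pastAlgebra Ω n ≤ MeasurableSpace.pi :=
  iSup₂_le fun i _ => (measurable_pi_apply i).comap_le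

lemma pastAlgebra_mono : Monotone (pastAlgebra Ω) := fun _ _ h =>
  biSup_mono fun _ hi => lt_of_lt_of_le hi h

lemma measurable_pastAlgebra_eval {i n : ℕ} (h : i < n) :
    Measurable[pastAlgebra Ω n] fun ω : ℕ → Ω => ω i :=
  (comap_measurable _).mono (le_iSup₂_of_le i h le_rfl) le_rfl

lemma indep_pastAlgebra [IsProbabilityMeasure μ] (n : ℕ) :
    Indep (pastAlgebra Ω n) (MeasurableSpace.comap (fun ω : ℕ → Ω => ω n) inferInstance)
      (iidLaw μ) := by
  have h : iIndepFun (fun (i : ℕ) (ω : ℕ → Ω) => ω i) (iidLaw μ) :=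
    iIndepFun_infinitePi (P := fun _ : ℕ => μ) (X := fun _ ω => ω) fun _ => measurable_id
  simpa only [Set.mem_singleton_iff, iSup_iSup_eq_left] using
    indep_iSup_of_disjoint (fun i => (measurable_pi_apply i).comap_le) h
      (S := Set.Iio n) (T := {n}) (by simp)

lemma integral_mul_past {𝕜 : Type*} [RCLike 𝕜] [IsProbabilityMeasure μ] {n : ℕ}
    {f : (ℕ → Ω) → 𝕜} {g : Ω → 𝕜} (hf : Measurable[pastAlgebra Ω n] f) (hg : Measurable g) :
    ∫ ω, g (ω n) * f ω ∂iidLaw μ = (∫ x, g x ∂μ) * ∫ ω, f ω ∂iidLaw μ := by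
  have hn := measurePreserving_eval_infinitePi (fun _ : ℕ => μ) n
  have hgn : Measurable fun ω : ℕ → Ω => g (ω n) := hg.comp hn.measurable
  have hindep : IndepFun (fun ω : ℕ → Ω => g (ω n)) f (iidLaw μ) := by
    rw [IndepFun_iff_Indep]
    refine indep_of_indep_of_le_left (indep_of_indep_of_le_right (indep_pastAlgebra n).symm
      hf.comap_le) ?_
    exact (hg.comp (comap_measurable _)).comap_le
  rw [hindep.integral_fun_mul_eq_mul_integral hgn.aestronglyMeasurable
    (hf.mono (pastAlgebra_le n) le_rfl).aestronglyMeasurable, ← hn.map_eq,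
    integral_map hn.measurable.aemeasurable hg.aestronglyMeasurable, hn.map_eq]

end Past

variable {d : ℕ} {Ω : Type*} [MeasurableSpace Ω] {r : CoinIdx d → Fin d → ℤ} {μ : Measure Ω}
  {C : Ω → Matrix.unitaryGroup (CoinIdx d) ℂ} {φ : CoinSpace d}

lemma measurable_pastAlgebra_evolve (hC : MeasurableCoin C) (φ : CoinSpace d) (n : ℕ)
    (x : Fin d → ℤ) (τ : CoinIdx d) :
    Measurable[pastAlgebra Ω n] fun ω => evolve r (coins C ω) (localized φ) n x τ := by
  induction n generalizing x τ with
  | zero =>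
    exact (measurable_const : Measurable[pastAlgebra Ω 0] fun _ : ℕ → Ω => localized φ x τ)
  | succ n ih =>
    simp only [evolve, step_apply, Matrix.mulVec, dotProduct]
    exact Finset.measurable_sum _ fun σ _ =>
      ((hC τ σ).comp (measurable_pastAlgebra_eval n.lt_succ_self)).mul
        ((ih (x - r τ) σ).mono (pastAlgebra_mono n.le_succ) le_rfl)

lemma measurable_evolve (hC : MeasurableCoin C) (φ : CoinSpace d) (n : ℕ) (x : Fin d → ℤ)
    (τ : CoinIdx d) : Measurable fun ω => evolve r (coins C ω) (localized φ) n x τ :=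
  (measurable_pastAlgebra_evolve hC φ n x τ).mono (pastAlgebra_le n) le_rfl

lemma measurable_pastAlgebra_correlation (hC : MeasurableCoin C) (φ : CoinSpace d) (n : ℕ)
    (p : (Fin d → ℤ) × (Fin d → ℤ)) (T : CoinIdx d × CoinIdx d) :
    Measurable[pastAlgebra Ω n] fun ω => correlation r (coins C ω) φ n p T :=
  (measurable_pastAlgebra_evolve hC φ n p.1 T.1).mul
    (Complex.continuous_conj.measurable.comp (measurable_pastAlgebra_evolve hC φ n p.2 T.2))

lemma integrable_correlation [IsProbabilityMeasure μ] (hC : MeasurableCoin C) (hφ : ‖φ‖ = 1)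
    (n : ℕ) (p : (Fin d → ℤ) × (Fin d → ℤ)) (T : CoinIdx d × CoinIdx d) :
    Integrable (fun ω => correlation r (coins C ω) φ n p T) (iidLaw μ) :=
  .of_bound ((measurable_pastAlgebra_correlation hC φ n p T).mono (pastAlgebra_le n)
    le_rfl).aestronglyMeasurable 1
    (ae_of_all _ fun ω => norm_correlation_le (fun i => (C (ω i)).2) hφ n p T)

/-- The two-point function `𝔼 (ψ_n(x) ⊗ \overline{ψ_n(x')})` at `p = (x, x')`. -/
noncomputable def twoPoint (r : CoinIdx d → Fin d → ℤ) (μ : Measure Ω)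
    (C : Ω → Matrix.unitaryGroup (CoinIdx d) ℂ) (φ : CoinSpace d) (n : ℕ)
    (p : (Fin d → ℤ) × (Fin d → ℤ)) (T : CoinIdx d × CoinIdx d) : ℂ :=
  ∫ ω, correlation r (coins C ω) φ n p T ∂iidLaw μ

lemma twoPoint_eq_zero {n : ℕ} {p : (Fin d → ℤ) × (Fin d → ℤ)}
    (hp : p ∉ reach r n ×ˢ reach r n) (T : CoinIdx d × CoinIdx d) :
    twoPoint r μ C φ n p T = 0 := by
  simp [twoPoint, correlation_eq_zero hp]

lemma twoPoint_succ [IsProbabilityMeasure μ] (hC : MeasurableCoin C) (hφ : ‖φ‖ = 1) (n : ℕ)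
    (p : (Fin d → ℤ) × (Fin d → ℤ)) (S : CoinIdx d × CoinIdx d) :
    twoPoint r μ C φ (n + 1) p S =
      ∑ T, meanTensor μ C S T * twoPoint r μ C φ n (p - (r S.1, r S.2)) T := by
  have hint (T) : Integrable (fun ω : ℕ → Ω => tensorConj (coins C ω n) S T *
      correlation r (coins C ω) φ n (p - (r S.1, r S.2)) T) (iidLaw μ) :=
    (integrable_correlation hC hφ n _ T).bdd_mul (c := 1)
      ((measurable_tensorConj hC S T).comp (measurable_pi_apply n)).aestronglyMeasurable
      (ae_of_all _ fun ω => norm_tensorConj_apply_le (C (ω n)) S T)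
  simp only [twoPoint, correlation_succ]
  rw [integral_finsetSum _ fun T _ => hint T]
  exact Finset.sum_congr rfl fun T _ => integral_mul_past
    (measurable_pastAlgebra_correlation hC φ n _ T) (measurable_tensorConj hC S T)

end TwoPoint


section Moments

section Fourier

variable {d : ℕ}

/-- The character `exp (i v · (x' - x))` at `p = (x, x')`. -/
noncomputable def phase (v : Fin d → ℝ) (p : (Fin d → ℤ) × (Fin d → ℤ)) : ℂ :=
  Complex.exp (Complex.I * ((∑ i, ((-v) i * p.1 i + v i * p.2 i) : ℝ) : ℂ))

lemma phase_add (v : Fin d → ℝ) (p q : (Fin d → ℤ) × (Fin d → ℤ)) :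
    phase v (p + q) = phase v p * phase v q := by
  rw [phase, phase, phase, ← Complex.exp_add, ← mul_add, ← Complex.ofReal_add,
    ← Finset.sum_add_distrib]
  congr! 4 with i
  simp only [Prod.fst_add, Prod.snd_add, Pi.add_apply, Int.cast_add]
  ring

lemma continuous_phase (p : (Fin d → ℤ) × (Fin d → ℤ)) :
    Continuous fun v : Fin d → ℝ => phase v p := by
  unfold phase
  simp only [Pi.neg_apply]
  fun_prop

/-- One period of the momentum space. -/
def periodBox (d : ℕ) : Set (Fin d → ℝ) :=
  Set.univ.pi fun _ : Fin d => Set.Ico (0 : ℝ) (2 * Real.pi)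

lemma periodBox_subset (d : ℕ) :
    periodBox d ⊆ Set.Icc (0 : Fin d → ℝ) (fun _ => 2 * Real.pi) := fun _ hv =>
  ⟨fun i => (hv i trivial).1, fun i => (hv i trivial).2.le⟩

lemma measurableSet_periodBox (d : ℕ) : MeasurableSet (periodBox d) :=
  MeasurableSet.univ_pi fun _ => measurableSet_Ico

lemma volume_periodBox_lt_top (d : ℕ) : volume (periodBox d) < ⊤ :=
  (measure_mono (periodBox_subset d)).trans_lt isCompact_Icc.measure_lt_top

lemma integrableOn_periodBox {f : (Fin d → ℝ) → ℂ} (hf : Continuous f) :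
    IntegrableOn f (periodBox d) :=
  (hf.continuousOn.integrableOn_compact isCompact_Icc).mono_set (periodBox_subset d)

lemma integral_exp_int (k : ℤ) :
    ∫ t in Set.Ico (0 : ℝ) (2 * Real.pi), Complex.exp (Complex.I * k * t) =
      if k = 0 then (2 * Real.pi : ℂ) else 0 := by
  rw [integral_Ico_eq_integral_Ioc, ← intervalIntegral.integral_of_le Real.two_pi_pos.le]
  split_ifs with hk
  · simp [hk]
  · have hexp : Complex.exp (Complex.I * k * ((2 * Real.pi : ℝ) : ℂ)) = 1 :=
      Complex.exp_eq_one_iff.2 ⟨k, by push_cast; ring⟩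
    rw [integral_exp_mul_complex (mul_ne_zero Complex.I_ne_zero (Int.cast_ne_zero.2 hk)), hexp]
    simp

lemma phase_eq_prod (v : Fin d → ℝ) (p : (Fin d → ℤ) × (Fin d → ℤ)) :
    phase v p = ∏ i, Complex.exp (Complex.I * ((p.2 i - p.1 i : ℤ) : ℂ) * v i) := by
  rw [phase, ← Complex.exp_sum, Complex.ofReal_sum, Finset.mul_sum]
  congr! 2 with i
  push_cast [Pi.neg_apply]
  ring

lemma integral_phase (p : (Fin d → ℤ) × (Fin d → ℤ)) :
    ∫ v in periodBox d, phase v p = if p.1 = p.2 then (2 * Real.pi : ℂ) ^ d else 0 := by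
  simp only [phase_eq_prod]
  rw [periodBox, volume_pi, Measure.restrict_pi_pi, integral_fintype_prod_eq_prod
    (f := fun i (t : ℝ) => Complex.exp (Complex.I * ((p.2 i - p.1 i : ℤ) : ℂ) * t))]
  simp only [integral_exp_int]
  split_ifs with h
  · simp [h]
  · obtain ⟨i, hi⟩ := Function.ne_iff.1 h
    exact Finset.prod_eq_zero (Finset.mem_univ i) (if_neg (sub_ne_zero.2 hi.symm))

end Fourier

variable {d : ℕ} {Ω : Type*} [MeasurableSpace Ω] {r : CoinIdx d → Fin d → ℤ} {μ : Measure Ω}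
  {C : Ω → Matrix.unitaryGroup (CoinIdx d) ℂ} {φ : CoinSpace d}

lemma meanMat_apply (v : Fin d → ℝ) (S T : CoinIdx d × CoinIdx d) :
    meanMat r μ C (-v) v S T = phase v (r S.1, r S.2) * meanTensor μ C S T := by
  rw [meanMat, phaseMat, Matrix.diagonal_mul, phase]

lemma displacement_add (z : Fin d → ℝ) (m n : ℕ) (x y : Fin d → ℤ) :
    displacement r z (m + n) (x + y) = displacement r z m x + displacement r z n y := by
  simp only [displacement, ← dotProduct_add]
  congr 1
  ext i
  simp only [Pi.add_apply]
  push_cast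
  ring

/-- The Fourier transform at `(-v, v)` of the two-point function, weighted by the `m`-th power of
the displacement. -/
noncomputable def momentVec (r : CoinIdx d → Fin d → ℤ) (μ : Measure Ω)
    (C : Ω → Matrix.unitaryGroup (CoinIdx d) ℂ) (φ : CoinSpace d) (z v : Fin d → ℝ) (m n : ℕ) :
    TensorSpace d :=
  .toLp 2 fun S => ∑' p : (Fin d → ℤ) × (Fin d → ℤ),
    (displacement r z n p.1 : ℂ) ^ m * phase v p * twoPoint r μ C φ n p S

lemma momentVec_apply (z v : Fin d → ℝ) (m n : ℕ) (S : CoinIdx d × CoinIdx d) :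
    momentVec r μ C φ z v m n S = ∑' p : (Fin d → ℤ) × (Fin d → ℤ),
      (displacement r z n p.1 : ℂ) ^ m * phase v p * twoPoint r μ C φ n p S := rfl

lemma summable_momentVec (z v : Fin d → ℝ) (m n : ℕ) (S : CoinIdx d × CoinIdx d) :
    Summable fun p : (Fin d → ℤ) × (Fin d → ℤ) =>
      (displacement r z n p.1 : ℂ) ^ m * phase v p * twoPoint r μ C φ n p S :=
  summable_of_ne_finset_zero (s := reach r n ×ˢ reach r n) fun p hp => by
    rw [twoPoint_eq_zero hp, mul_zero]

lemma weighted_twoPoint_succ [IsProbabilityMeasure μ] (hC : MeasurableCoin C) (hφ : ‖φ‖ = 1)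
    (z v : Fin d → ℝ) (m n : ℕ) (p : (Fin d → ℤ) × (Fin d → ℤ)) (S : CoinIdx d × CoinIdx d) :
    (displacement r z (n + 1) (p.1 + r S.1) : ℂ) ^ m * phase v (p + (r S.1, r S.2)) *
        twoPoint r μ C φ (n + 1) (p + (r S.1, r S.2)) S =
      ∑ j ∈ Finset.range (m + 1), ∑ T,
        (m.choose j * (displacement r z 1 (r S.1) : ℂ) ^ j * meanMat r μ C (-v) v S T) *
          ((displacement r z n p.1 : ℂ) ^ (m - j) * phase v p * twoPoint r μ C φ n p T) := by
  rw [displacement_add, add_comm (displacement r z n p.1), Complex.ofReal_add, add_pow, phase_add,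
    twoPoint_succ hC hφ, add_sub_cancel_right, mul_assoc, Finset.sum_mul]
  refine Finset.sum_congr rfl fun j _ => ?_
  rw [Finset.mul_sum, Finset.mul_sum]
  refine Finset.sum_congr rfl fun T _ => ?_
  rw [meanMat_apply]
  ring

lemma isMomentSeq_momentVec [IsProbabilityMeasure μ] (hC : MeasurableCoin C) (hφ : ‖φ‖ = 1)
    (z v : Fin d → ℝ) : IsMomentSeq (jumpOp r z) (meanOp r μ C v) (momentVec r μ C φ z v) := by
  intro m n
  ext S
  rw [momentVec_apply, ← (Equiv.addRight (r S.1, r S.2)).tsum_eq]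
  refine (tsum_congr fun p => weighted_twoPoint_succ hC hφ z v m n p S).trans ?_
  have hsum (k T) (c : ℂ) := (summable_momentVec (r := r) (μ := μ) (C := C) (φ := φ)
    z v k n T).mul_left c
  rw [Summable.tsum_finsetSum fun j _ => summable_sum fun T _ => hsum _ T _, WithLp.ofLp_sum,
    Finset.sum_apply]
  refine Finset.sum_congr rfl fun j _ => ?_
  rw [Summable.tsum_finsetSum fun T _ => hsum _ T _, PiLp.smul_apply, jumpOp, firstMul_pow,
    firstMul_apply, meanOp, toEuclideanCLM_apply_apply, smul_eq_mul, Finset.mul_sum,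
    Finset.mul_sum]
  refine Finset.sum_congr rfl fun T _ => ?_
  rw [tsum_mul_left, momentVec_apply, Pi.pow_apply, mul_assoc, mul_assoc]

lemma momentVec_zero [IsProbabilityMeasure μ] (z v : Fin d → ℝ) (m : ℕ) :
    momentVec r μ C φ z v m 0 =
      (0 : ℂ) ^ m • .toLp 2 fun S => φ S.1 * (starRingEnd ℂ) (φ S.2) := by
  ext S
  rw [momentVec_apply, tsum_eq_single (0, 0) fun p hp => by
    rw [twoPoint_eq_zero (by simpa [reach, Prod.ext_iff] using hp), mul_zero]]
  simp [displacement, phase, twoPoint, correlation, evolve, localized]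

lemma norm_momentVec_zero_le [IsProbabilityMeasure μ] (z v : Fin d → ℝ) (m : ℕ) :
    ‖momentVec r μ C φ z v m 0‖ ≤
      ‖(.toLp 2 fun S => φ S.1 * (starRingEnd ℂ) (φ S.2) : TensorSpace d)‖ := by
  rw [momentVec_zero, norm_smul, norm_pow, norm_zero]
  exact mul_le_of_le_one_left (norm_nonneg _) (pow_le_one₀ le_rfl zero_le_one)

lemma traceForm_momentVec_zero_zero [IsProbabilityMeasure μ] (hφ : ‖φ‖ = 1) (z v : Fin d → ℝ) :
    traceForm d (momentVec r μ C φ z v 0 0) = 1 := by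
  have h := EuclideanSpace.norm_sq_eq φ
  rw [hφ, one_pow] at h
  rw [momentVec_zero, pow_zero, one_smul, traceForm_apply]
  simp only [Complex.mul_conj, Complex.normSq_eq_norm_sq, ← Complex.ofReal_sum, ← h,
    Complex.ofReal_one]

lemma traceForm_momentVec_eq_sum (z v : Fin d → ℝ) (m n : ℕ) :
    traceForm d (momentVec r μ C φ z v m n) = ∑ p ∈ reach r n ×ˢ reach r n,
      phase v p * ((displacement r z n p.1 : ℂ) ^ m * ∑ τ, twoPoint r μ C φ n p (τ, τ)) := by
  have hsum (S) : momentVec r μ C φ z v m n S = ∑ p ∈ reach r n ×ˢ reach r n,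
      (displacement r z n p.1 : ℂ) ^ m * phase v p * twoPoint r μ C φ n p S :=
    tsum_eq_sum fun p hp => by rw [twoPoint_eq_zero hp, mul_zero]
  simp only [traceForm_apply, hsum]
  rw [Finset.sum_comm]
  refine Finset.sum_congr rfl fun p _ => ?_
  rw [Finset.mul_sum, Finset.mul_sum]
  exact Finset.sum_congr rfl fun τ _ => by ring

lemma continuous_traceForm_momentVec (z : Fin d → ℝ) (m n : ℕ) :
    Continuous fun v => traceForm d (momentVec r μ C φ z v m n) := by
  simp only [traceForm_momentVec_eq_sum]
  exact continuous_finsetSum _ fun p _ => (continuous_phase p).mul continuous_const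

/-- The averaged moments of the displacement. -/
noncomputable def moment (r : CoinIdx d → Fin d → ℤ) (μ : Measure Ω)
    (C : Ω → Matrix.unitaryGroup (CoinIdx d) ℂ) (φ : CoinSpace d) (z : Fin d → ℝ) (m n : ℕ) : ℝ :=
  ∫ ω, ∑' x, posProb r (coins C ω) φ n x * displacement r z n x ^ m ∂iidLaw μ

lemma ofReal_moment [IsProbabilityMeasure μ] (hC : MeasurableCoin C) (hφ : ‖φ‖ = 1)
    (z : Fin d → ℝ) (m n : ℕ) :
    (moment r μ C φ z m n : ℂ) = ∑ x ∈ reach r n,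
      (displacement r z n x : ℂ) ^ m * ∑ τ, twoPoint r μ C φ n (x, x) (τ, τ) := by
  have hpoint (ω : ℕ → Ω) :
      ((∑' x, posProb r (coins C ω) φ n x * displacement r z n x ^ m : ℝ) : ℂ) =
        ∑ x ∈ reach r n, (displacement r z n x : ℂ) ^ m *
          ∑ τ, correlation r (coins C ω) φ n (x, x) (τ, τ) := by
    rw [tsum_eq_sum (s := reach r n) fun x hx => by
      rw [posProb_eq_zero_of_notMem_reach hx, zero_mul]]
    simp [sum_correlation_self, mul_comm]
  have hint (x τ) := integrable_correlation (r := r) (μ := μ) hC hφ n (x, x) (τ, τ)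
  rw [moment, ← integral_complex_ofReal]
  simp only [hpoint, twoPoint]
  rw [integral_finsetSum _ fun x _ => (integrable_finsetSum _ fun τ _ => hint x τ).const_mul _]
  refine Finset.sum_congr rfl fun x _ => ?_
  rw [integral_const_mul, integral_finsetSum _ fun τ _ => hint x τ]

lemma integral_traceForm_momentVec [IsProbabilityMeasure μ] (hC : MeasurableCoin C) (hφ : ‖φ‖ = 1)
    (z : Fin d → ℝ) (m n : ℕ) :
    ∫ v in periodBox d, traceForm d (momentVec r μ C φ z v m n) =
      (2 * Real.pi : ℂ) ^ d * moment r μ C φ z m n := by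
  simp only [traceForm_momentVec_eq_sum]
  rw [integral_finsetSum _ fun p _ => (integrableOn_periodBox (continuous_phase p)).mul_const _]
  simp only [integral_mul_const, integral_phase, ite_mul, zero_mul, Finset.sum_product]
  rw [ofReal_moment hC hφ, Finset.mul_sum]
  exact Finset.sum_congr rfl fun x hx => by simp [hx]

end Moments

section ConvergenceOfMeans

variable {ι : Type*} {Ω : ι → Type*} [∀ i, MeasurableSpace (Ω i)] {P : (i : ι) → Measure (Ω i)}
variable [∀ i, IsProbabilityMeasure (P i)] {Ω' : Type*} [MeasurableSpace Ω'] {ν : Measure Ω'}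
variable [IsProbabilityMeasure ν] {l : Filter ι}

section Topological

variable {E : Type*} [TopologicalSpace E] [MeasurableSpace E] [OpensMeasurableSpace E]
variable {X : (i : ι) → Ω i → E} {Z : Ω' → E}

lemma tendsto_integral_boundedContinuousFunction (h : TendstoInDistribution X l Z P ν)
    (f : BoundedContinuousFunction E ℝ) :
    Tendsto (fun i => ∫ ω, f (X i ω) ∂P i) l (𝓝 (∫ ω, f (Z ω) ∂ν)) := by
  have hf := ProbabilityMeasure.tendsto_iff_forall_integral_tendsto.1 h.tendsto f
  have hmeas (Q : Measure E) : AEStronglyMeasurable f Q :=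
    f.continuous.measurable.aestronglyMeasurable
  simpa only [ProbabilityMeasure.coe_mk, integral_map (h.forall_aemeasurable _) (hmeas _),
    integral_map h.aemeasurable_limit (hmeas _)] using hf

lemma lintegral_le_of_tendstoInDistribution [l.NeBot] (h : TendstoInDistribution X l Z P ν)
    {f : E → NNReal} (hf : Continuous f) {K : ENNReal}
    (hK : ∀ i, ∫⁻ ω, f (X i ω) ∂P i ≤ K) : ∫⁻ ω, f (Z ω) ∂ν ≤ K := by
  have htrunc (L : ℕ) : ∫⁻ ω, ((min (f (Z ω)) L : NNReal) : ENNReal) ∂ν ≤ K := by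
    let g : BoundedContinuousFunction E NNReal :=
      BoundedContinuousFunction.mkOfBound ⟨fun x => min (f x) L, by fun_prop⟩ L fun x y =>
        abs_sub_le_of_nonneg_of_le (NNReal.coe_nonneg _) (by exact_mod_cast min_le_right _ _)
          (NNReal.coe_nonneg _) (by exact_mod_cast min_le_right _ _)
    have hg := ProbabilityMeasure.tendsto_iff_forall_lintegral_tendsto.1 h.tendsto g
    have hmeas : Measurable fun x => (g x : ENNReal) := g.continuous.measurable.coe_nnreal_ennreal
    simp only [ProbabilityMeasure.coe_mk, lintegral_map' hmeas.aemeasurable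
      (h.forall_aemeasurable _), lintegral_map' hmeas.aemeasurable h.aemeasurable_limit] at hg
    exact le_of_tendsto' hg fun i => (lintegral_mono fun ω => by
      exact ENNReal.coe_le_coe.2 (min_le_left _ _)).trans (hK i)
  have hsup (x : E) : (f x : ENNReal) = ⨆ L : ℕ, ((min (f x) L : NNReal) : ENNReal) := by
    refine le_antisymm ?_ (iSup_le fun L => ENNReal.coe_le_coe.2 (min_le_left _ _))
    obtain ⟨L, hL⟩ := exists_nat_ge (f x)
    exact le_iSup_of_le L (ENNReal.coe_le_coe.2 (le_min le_rfl hL))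
  simp only [hsup]
  rw [lintegral_iSup']
  · exact iSup_le htrunc
  · exact fun L => ((hf.min continuous_const).measurable.comp_aemeasurable
      h.aemeasurable_limit).coe_nnreal_ennreal
  · exact ae_of_all _ fun ω a b hab => by
      have : (a : NNReal) ≤ b := by exact_mod_cast hab
      exact ENNReal.coe_le_coe.2 (min_le_min_left _ this)

end Topological

section Real

/-- Truncation of the real line to `[-|L|, |L|]`; the absolute value spares a sign condition on
`L`. -/
def truncation (L : ℝ) : BoundedContinuousFunction ℝ ℝ :=
  BoundedContinuousFunction.ofNormedAddCommGroup (fun x => max (-|L|) (min x |L|))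
    (by fun_prop) |L| fun x => abs_le.2
      ⟨le_max_left _ _, max_le ((neg_nonpos.2 (abs_nonneg L)).trans (abs_nonneg L))
        (min_le_right _ _)⟩

lemma abs_sub_truncation_le {L : ℝ} (hL : 0 < L) (x : ℝ) :
    |x - truncation L x| ≤ x ^ 2 / L := by
  change |x - max (-|L|) (min x |L|)| ≤ x ^ 2 / L
  rw [abs_of_pos hL, le_div_iff₀ hL]
  rcases le_total x L with hx | hx
  · rw [min_eq_left hx]
    rcases le_total (-L) x with hx' | hx'
    · rw [max_eq_right hx', sub_self, abs_zero, zero_mul]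
      positivity
    · rw [max_eq_left hx', abs_of_nonpos (by linarith)]
      nlinarith
  · rw [min_eq_right hx, max_eq_right (by linarith), abs_of_nonneg (by linarith)]
    nlinarith

lemma abs_integral_sub_integral_truncation_le {Y : Ω' → ℝ} (hY : MemLp Y 2 ν) {K L : ℝ}
    (hL : 0 < L) (hK : ∫ ω, Y ω ^ 2 ∂ν ≤ K) :
    |∫ ω, Y ω ∂ν - ∫ ω, truncation L (Y ω) ∂ν| ≤ K / L := by
  have hY1 : Integrable Y ν := hY.integrable one_le_two
  have htrunc : Integrable (fun ω => truncation L (Y ω)) ν :=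
    Integrable.of_bound ((truncation L).continuous.comp_aestronglyMeasurable hY.1) ‖truncation L‖
      (ae_of_all _ fun _ => (truncation L).norm_coe_le_norm _)
  rw [← integral_sub hY1 htrunc]
  calc |∫ ω, (Y ω - truncation L (Y ω)) ∂ν| ≤ ∫ ω, |Y ω - truncation L (Y ω)| ∂ν :=
        abs_integral_le_integral_abs
    _ ≤ ∫ ω, Y ω ^ 2 / L ∂ν :=
        integral_mono (hY1.sub htrunc).abs (hY.integrable_sq.div_const L) fun ω =>
          abs_sub_truncation_le hL _
    _ = (∫ ω, Y ω ^ 2 ∂ν) / L := integral_div _ _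
    _ ≤ K / L := by gcongr

variable {X : (i : ι) → Ω i → ℝ} {Z : Ω' → ℝ} {K : ℝ}

lemma memLp_two_of_tendstoInDistribution [l.NeBot] (h : TendstoInDistribution X l Z P ν)
    (hX : ∀ i, MemLp (X i) 2 (P i)) (hK : ∀ i, ∫ ω, X i ω ^ 2 ∂P i ≤ K) :
    MemLp Z 2 ν ∧ ∫ ω, Z ω ^ 2 ∂ν ≤ K := by
  have hZ := h.aemeasurable_limit.aestronglyMeasurable
  have hle : ∫⁻ ω, ENNReal.ofReal (Z ω ^ 2) ∂ν ≤ ENNReal.ofReal K :=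
    lintegral_le_of_tendstoInDistribution h (f := fun x => Real.toNNReal (x ^ 2)) (by fun_prop)
      fun i => by
        have := ofReal_integral_eq_lintegral_ofReal (hX i).integrable_sq
          (ae_of_all _ fun ω => sq_nonneg (X i ω))
        exact this.symm.trans_le (ENNReal.ofReal_le_ofReal (hK i))
  have hint : Integrable (fun ω => Z ω ^ 2) ν :=
    ⟨hZ.pow 2, (hasFiniteIntegral_iff_ofReal (ae_of_all _ fun ω => sq_nonneg (Z ω))).2
      (hle.trans_lt ENNReal.ofReal_lt_top)⟩
  obtain ⟨i⟩ := l.nonempty_of_neBot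
  have hK0 : 0 ≤ K := (integral_nonneg fun ω => sq_nonneg _).trans (hK i)
  refine ⟨(memLp_two_iff_integrable_sq hZ).2 hint, ?_⟩
  rwa [← ofReal_integral_eq_lintegral_ofReal hint (ae_of_all _ fun ω => sq_nonneg _),
    ENNReal.ofReal_le_ofReal_iff hK0] at hle

lemma tendsto_integral_of_tendstoInDistribution [l.NeBot] (h : TendstoInDistribution X l Z P ν)
    (hX : ∀ i, MemLp (X i) 2 (P i)) (hK : ∀ i, ∫ ω, X i ω ^ 2 ∂P i ≤ K) :
    Tendsto (fun i => ∫ ω, X i ω ∂P i) l (𝓝 (∫ ω, Z ω ∂ν)) := by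
  obtain ⟨hZ, hKZ⟩ := memLp_two_of_tendstoInDistribution h hX hK
  rw [Metric.tendsto_nhds]
  intro ε hε
  obtain ⟨L, hKL, hL⟩ : ∃ L : ℝ, K / L < ε / 3 ∧ 0 < L :=
    (((tendsto_const_nhds.div_atTop tendsto_id).eventually_lt_const (by positivity)).and
      (eventually_gt_atTop 0)).exists
  filter_upwards [Metric.tendsto_nhds.1
    (tendsto_integral_boundedContinuousFunction h (truncation L)) (ε / 3) (by positivity)] with i hi
  have hXL := abs_integral_sub_integral_truncation_le (hX i) hL (hK i)
  have hZL := abs_integral_sub_integral_truncation_le hZ hL hKZ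
  rw [Real.dist_eq] at hi ⊢
  rw [abs_le] at hXL hZL
  rw [abs_lt] at hi ⊢
  constructor <;> linarith [hXL.1, hXL.2, hZL.1, hZL.2, hi.1, hi.2]

end Real

end ConvergenceOfMeans

section Diffusion

variable {d : ℕ} {Ω : Type*} [MeasurableSpace Ω] {r : CoinIdx d → Fin d → ℤ} {μ : Measure Ω}
variable {C : Ω → Matrix.unitaryGroup (CoinIdx d) ℂ} {φ : CoinSpace d}
variable {A : ℕ → Matrix (CoinIdx d) (CoinIdx d) ℂ}

section MomentAsymptotics

variable [NeZero d] [IsProbabilityMeasure μ]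

lemma AssumptionS.uniformGrowth_momentVec (hS : AssumptionS r μ C) (hC : MeasurableCoin C)
    (hφ : ‖φ‖ = 1) (z : Fin d → ℝ) (m : ℕ) :
    UniformGrowth (m / 2) (fun (v : periodBox d) n =>
        remainder (meanVec d) (traceForm d) (momentVec r μ C φ z v m n)) ∧
      UniformGrowth ((m + 1) / 2) (fun (v : periodBox d) n => momentVec r μ C φ z v m n) := by
  obtain ⟨B, hB⟩ := hS.exists_sum_norm_deflate_pow_le hC
    (isCompact_Icc (a := (0 : Fin d → ℝ)) (b := fun _ => 2 * Real.pi))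
  exact IsMomentSeq.uniformGrowth (ι := periodBox d) (fun v => isMomentSeq_momentVec hC hφ z v)
    (fun v => isFixedPair_meanOp hC v) (traceForm_jumpOp_meanVec z)
    (fun v => norm_meanOp_le_one hC v) (fun v => hB v (periodBox_subset d v.2))
    (fun v m => norm_momentVec_zero_le z v m) m

lemma inv_mul_add_one_le_two (n : ℕ) : (n : ℝ)⁻¹ * (n + 1) ≤ 2 := by
  rcases n.eq_zero_or_pos with rfl | hn
  · simp
  · have : (1 : ℝ) ≤ n := by exact_mod_cast hn
    rw [inv_mul_le_iff₀ (by positivity)]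
    linarith

lemma AssumptionS.exists_norm_traceForm_momentVec_le (hS : AssumptionS r μ C)
    (hC : MeasurableCoin C) (hφ : ‖φ‖ = 1) (z : Fin d → ℝ) (m : ℕ) :
    ∃ c, 0 ≤ c ∧ ∀ v ∈ periodBox d, ∀ n : ℕ,
      ‖traceForm d (momentVec r μ C φ z v m n)‖ ≤ c * ((n : ℝ) + 1) ^ ((m + 1) / 2) := by
  obtain ⟨c, hc, h⟩ :=
    ((hS.uniformGrowth_momentVec hC hφ z m).2.map (traceForm d)).exists_nonneg_bound
  exact ⟨c, hc, fun v hv n => h ⟨v, hv⟩ n⟩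

lemma AssumptionS.exists_abs_moment_le (hS : AssumptionS r μ C) (hC : MeasurableCoin C)
    (hφ : ‖φ‖ = 1) (z : Fin d → ℝ) (m : ℕ) :
    ∃ c, 0 ≤ c ∧ ∀ n : ℕ, |moment r μ C φ z m n| ≤ c * ((n : ℝ) + 1) ^ ((m + 1) / 2) := by
  obtain ⟨c, hc, hbound⟩ := hS.exists_norm_traceForm_momentVec_le hC hφ z m
  refine ⟨((2 * Real.pi) ^ d)⁻¹ * (c * volume.real (periodBox d)), by positivity, fun n => ?_⟩
  have hnorm := congrArg norm (integral_traceForm_momentVec (r := r) (μ := μ) hC hφ z m n)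
  have hint := norm_setIntegral_le_of_norm_le_const (volume_periodBox_lt_top d)
    fun v hv => hbound v hv n
  rw [hnorm, norm_mul, norm_pow, Complex.norm_real, Real.norm_eq_abs] at hint
  have hpi : ‖(2 * Real.pi : ℂ)‖ = 2 * Real.pi := by
    rw [norm_mul, Complex.norm_real, Real.norm_of_nonneg Real.pi_nonneg, Complex.norm_two]
  rw [hpi] at hint
  rw [mul_assoc, le_inv_mul_iff₀ (by positivity)]
  linarith

lemma AssumptionS.tendsto_traceForm_momentVec_two (hS : AssumptionS r μ C) (hC : MeasurableCoin C)
    (hφ : ‖φ‖ = 1) (z : Fin d → ℝ) {v : Fin d → ℝ} (hv : v ∈ periodBox d) :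
    Tendsto (fun n : ℕ => (n : ℂ)⁻¹ * traceForm d (momentVec r μ C φ z v 2 n)) atTop
      (𝓝 (∑ i, ∑ j, (z i : ℂ) * diffusionAt r μ C v i j * (z j : ℂ))) := by
  obtain ⟨c₀, hc₀⟩ :=
    UniformGrowth.zero_iff_exists_bound.1 (hS.uniformGrowth_momentVec hC hφ z 0).1
  obtain ⟨c₁, hc₁⟩ :=
    UniformGrowth.zero_iff_exists_bound.1 (hS.uniformGrowth_momentVec hC hφ z 1).1
  rw [← hS.limit_eq_sum_diffusionAt hC v z]
  exact (isMomentSeq_momentVec hC hφ z v).tendsto_form_two (isFixedPair_meanOp hC v)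
    (traceForm_jumpOp_meanVec z) (hS.shiftedInv_mul hC v) (hS.mul_shiftedInv hC v)
    (traceForm_momentVec_zero_zero hφ z v)
    (fun n => (hc₀ ⟨v, hv⟩ n).trans (le_max_left c₀ c₁))
    (fun n => (hc₁ ⟨v, hv⟩ n).trans (le_max_right c₀ c₁))

lemma AssumptionS.sum_sum_diffusion (hS : AssumptionS r μ C) (hC : MeasurableCoin C)
    (z : Fin d → ℝ) :
    ∑ i, ∑ j, (z i : ℂ) * diffusion r μ C i j * (z j : ℂ) = ((2 * Real.pi : ℂ) ^ d)⁻¹ *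
      ∫ v in periodBox d, ∑ i, ∑ j, (z i : ℂ) * diffusionAt r μ C v i j * (z j : ℂ) := by
  have hint (i j) : IntegrableOn (fun v => (z i : ℂ) * diffusionAt r μ C v i j * (z j : ℂ))
      (periodBox d) :=
    integrableOn_periodBox
      ((continuous_const.mul (hS.continuous_diffusionAt hC i j)).mul continuous_const)
  rw [integral_finsetSum _ fun i _ => integrable_finsetSum _ fun j _ => hint i j, Finset.mul_sum]
  refine Finset.sum_congr rfl fun i _ => ?_
  rw [integral_finsetSum _ fun j _ => hint i j, Finset.mul_sum]
  refine Finset.sum_congr rfl fun j _ => ?_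
  rw [integral_mul_const, integral_const_mul, diffusion, periodBox]
  ring

lemma AssumptionS.tendsto_moment_two (hS : AssumptionS r μ C) (hC : MeasurableCoin C)
    (hφ : ‖φ‖ = 1) (z : Fin d → ℝ) :
    Tendsto (fun n : ℕ => (((n : ℝ)⁻¹ * moment r μ C φ z 2 n : ℝ) : ℂ)) atTop
      (𝓝 (∑ i, ∑ j, (z i : ℂ) * diffusion r μ C i j * (z j : ℂ))) := by
  obtain ⟨c, hc, hbound⟩ := hS.exists_norm_traceForm_momentVec_le hC hφ z 2
  have hdom : Tendsto (fun n : ℕ => ∫ v in periodBox d,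
      (n : ℂ)⁻¹ * traceForm d (momentVec r μ C φ z v 2 n)) atTop
      (𝓝 (∫ v in periodBox d, ∑ i, ∑ j, (z i : ℂ) * diffusionAt r μ C v i j * (z j : ℂ))) := by
    refine tendsto_integral_of_dominated_convergence (fun _ => c * 2)
      (fun n => (continuous_const.mul
        (continuous_traceForm_momentVec z 2 n)).aestronglyMeasurable)
      (integrableOn_const (volume_periodBox_lt_top d).ne) (fun n => ?_) ?_
    · filter_upwards [ae_restrict_mem (measurableSet_periodBox d)] with v hv
      calc ‖(n : ℂ)⁻¹ * traceForm d (momentVec r μ C φ z v 2 n)‖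
          ≤ (n : ℝ)⁻¹ * (c * (n + 1)) := by
            rw [norm_mul, norm_inv, Complex.norm_natCast]
            gcongr
            simpa using hbound v hv n
        _ = c * ((n : ℝ)⁻¹ * (n + 1)) := by ring
        _ ≤ c * 2 := by gcongr; exact inv_mul_add_one_le_two n
    · filter_upwards [ae_restrict_mem (measurableSet_periodBox d)] with v hv
      exact hS.tendsto_traceForm_momentVec_two hC hφ z hv
  rw [hS.sum_sum_diffusion hC]
  refine (hdom.const_mul _).congr fun n => ?_
  have hpi : (2 * Real.pi : ℂ) ^ d ≠ 0 := by simp [Real.pi_ne_zero]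
  rw [integral_const_mul, integral_traceForm_momentVec hC hφ]
  push_cast
  field_simp

end MomentAsymptotics

section QuadForm

lemma quadForm_eq (z : Fin d → ℝ) (n : ℕ) : quadForm r A φ z n =
    (n : ℝ)⁻¹ * ∑' x, posProb r A φ n x * displacement r z n x ^ 2 := by
  rw [quadForm, ← tsum_mul_left]
  refine tsum_congr fun x => ?_
  have h : z ⬝ᵥ rescaled r n x = displacement r z n x / √(n : ℝ) := by
    simp only [displacement, dotProduct, rescaled, Finset.sum_div, mul_div_assoc]
  rw [dotProduct_comm (rescaled r n x) z, h, div_mul_div_comm, Real.mul_self_sqrt n.cast_nonneg]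
  ring

lemma tsum_posProb_mul_eq_sum (n : ℕ) (w : (Fin d → ℤ) → ℝ) :
    ∑' x, posProb r A φ n x * w x = ∑ x ∈ reach r n, posProb r A φ n x * w x :=
  tsum_eq_sum fun x hx => by rw [posProb_eq_zero_of_notMem_reach hx, zero_mul]

lemma posProb_nonneg (n : ℕ) (x : Fin d → ℤ) : 0 ≤ posProb r A φ n x :=
  sq_nonneg _

lemma sq_tsum_posProb_mul_le (hA : ∀ n, A n ∈ Matrix.unitaryGroup (CoinIdx d) ℂ) (hφ : ‖φ‖ = 1)
    (n : ℕ) (w : (Fin d → ℤ) → ℝ) :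
    (∑' x, posProb r A φ n x * w x) ^ 2 ≤ ∑' x, posProb r A φ n x * w x ^ 2 := by
  have hsum : ∑ x ∈ reach r n, posProb r A φ n x = 1 :=
    (hasSum_sum_of_ne_finset_zero fun x hx => posProb_eq_zero_of_notMem_reach hx).unique
      (hasSum_posProb hA hφ n)
  simp only [tsum_posProb_mul_eq_sum]
  have hCS := Finset.sum_sq_le_sum_mul_sum_of_sq_le_mul (reach r n)
    (r := fun x => posProb r A φ n x * w x) (f := posProb r A φ n)
    (g := fun x => posProb r A φ n x * w x ^ 2) (fun x _ => posProb_nonneg n x)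
    (fun x _ => mul_nonneg (posProb_nonneg n x) (sq_nonneg _)) (fun x _ => by ring_nf; rfl)
  rwa [hsum, one_mul] at hCS

lemma sq_quadForm_le (hA : ∀ n, A n ∈ Matrix.unitaryGroup (CoinIdx d) ℂ) (hφ : ‖φ‖ = 1)
    (z : Fin d → ℝ) (n : ℕ) : quadForm r A φ z n ^ 2 ≤
      (n : ℝ)⁻¹ ^ 2 * ∑' x, posProb r A φ n x * displacement r z n x ^ 4 := by
  rw [quadForm_eq, mul_pow]
  gcongr
  exact (sq_tsum_posProb_mul_le hA hφ n _).trans_eq (tsum_congr fun x => by ring)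

lemma measurable_posProb (hC : MeasurableCoin C) (n : ℕ) (x : Fin d → ℤ) :
    Measurable fun ω => posProb r (coins C ω) φ n x := by
  simp only [posProb, EuclideanSpace.norm_sq_eq]
  exact Finset.measurable_sum _ fun τ _ => (measurable_evolve hC φ n x τ).norm.pow_const 2

lemma memLp_tsum_posProb_mul [IsProbabilityMeasure μ] (hC : MeasurableCoin C) (hφ : ‖φ‖ = 1)
    (n : ℕ) (w : (Fin d → ℤ) → ℝ) (p : ENNReal) :
    MemLp (fun ω => ∑' x, posProb r (coins C ω) φ n x * w x) p (iidLaw μ) := by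
  simp only [tsum_posProb_mul_eq_sum]
  refine memLp_finsetSum _ fun x _ => MemLp.mul_const ?_ _
  refine MemLp.of_bound (measurable_posProb hC n x).aestronglyMeasurable 1
    (ae_of_all _ fun ω => ?_)
  rw [Real.norm_of_nonneg (posProb_nonneg n x)]
  exact le_hasSum (hasSum_posProb (fun i => (C (ω i)).2) hφ n) x fun y _ => posProb_nonneg n y

lemma memLp_quadForm [IsProbabilityMeasure μ] (hC : MeasurableCoin C) (hφ : ‖φ‖ = 1)
    (z : Fin d → ℝ) (n : ℕ) (p : ENNReal) :
    MemLp (fun ω => quadForm r (coins C ω) φ z n) p (iidLaw μ) := by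
  simp only [quadForm_eq]
  exact (memLp_tsum_posProb_mul hC hφ n _ p).const_mul _

lemma integral_quadForm (z : Fin d → ℝ) (n : ℕ) :
    ∫ ω, quadForm r (coins C ω) φ z n ∂iidLaw μ = (n : ℝ)⁻¹ * moment r μ C φ z 2 n := by
  simp only [quadForm_eq, integral_const_mul, moment]

lemma integral_sq_quadForm_le [IsProbabilityMeasure μ] (hC : MeasurableCoin C) (hφ : ‖φ‖ = 1)
    (z : Fin d → ℝ) (n : ℕ) :
    ∫ ω, quadForm r (coins C ω) φ z n ^ 2 ∂iidLaw μ ≤ (n : ℝ)⁻¹ ^ 2 * moment r μ C φ z 4 n := by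
  rw [moment, ← integral_const_mul]
  exact integral_mono (memLp_quadForm hC hφ z n 2).integrable_sq
    ((memLp_one_iff_integrable.1 (memLp_tsum_posProb_mul hC hφ n _ 1)).const_mul _)
    fun ω => sq_quadForm_le (fun i => (C (ω i)).2) hφ z n

end QuadForm

variable [NeZero d] [IsProbabilityMeasure μ]

lemma AssumptionS.exists_integral_sq_quadForm_le (hS : AssumptionS r μ C) (hC : MeasurableCoin C)
    (hφ : ‖φ‖ = 1) (z : Fin d → ℝ) :
    ∃ K, ∀ n, ∫ ω, quadForm r (coins C ω) φ z n ^ 2 ∂iidLaw μ ≤ K := by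
  obtain ⟨c, hc, hmoment⟩ := hS.exists_abs_moment_le hC hφ z 4
  refine ⟨c * 2 ^ 2, fun n => ?_⟩
  calc ∫ ω, quadForm r (coins C ω) φ z n ^ 2 ∂iidLaw μ
      ≤ (n : ℝ)⁻¹ ^ 2 * moment r μ C φ z 4 n := integral_sq_quadForm_le hC hφ z n
    _ ≤ (n : ℝ)⁻¹ ^ 2 * (c * ((n : ℝ) + 1) ^ 2) := by
        gcongr
        exact (le_abs_self _).trans (hmoment n)
    _ = c * ((n : ℝ)⁻¹ * (n + 1)) ^ 2 := by ring
    _ ≤ c * 2 ^ 2 := by gcongr; exact inv_mul_add_one_le_two n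

lemma AssumptionS.tendsto_integral_quadForm (hS : AssumptionS r μ C) (hC : MeasurableCoin C)
    (hφ : ‖φ‖ = 1) (z : Fin d → ℝ) :
    Tendsto (fun n => ((∫ ω, quadForm r (coins C ω) φ z n ∂iidLaw μ : ℝ) : ℂ)) atTop
      (𝓝 (∑ i, ∑ j, (z i : ℂ) * diffusion r μ C i j * (z j : ℂ))) := by
  simpa only [integral_quadForm] using hS.tendsto_moment_two hC hφ z

lemma AssumptionS.mean_of_tendstoInDistribution (hS : AssumptionS r μ C) (hC : MeasurableCoin C)
    (hφ : ‖φ‖ = 1) {Ω' : Type*} [MeasurableSpace Ω'] {ν : Measure Ω'} [IsProbabilityMeasure ν]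
    {z : Fin d → ℝ} {Z : Ω' → ℝ}
    (hZ : TendstoInDistribution (fun (n : ℕ) ω => quadForm r (coins C ω) φ z n) atTop Z
      (fun _ => iidLaw μ) ν) :
    Integrable Z ν ∧
      Tendsto (fun n => ∫ ω, quadForm r (coins C ω) φ z n ∂iidLaw μ) atTop
        (𝓝 (∫ ω, Z ω ∂ν)) ∧
      ((∫ ω, Z ω ∂ν : ℝ) : ℂ) = ∑ i, ∑ j, (z i : ℂ) * diffusion r μ C i j * (z j : ℂ) := by
  obtain ⟨K, hK⟩ := hS.exists_integral_sq_quadForm_le hC hφ z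
  have hL2 (n : ℕ) := memLp_quadForm (r := r) (μ := μ) hC hφ z n 2
  have hmean := tendsto_integral_of_tendstoInDistribution hZ hL2 hK
  exact ⟨(memLp_two_of_tendstoInDistribution hZ hL2 hK).1.integrable one_le_two, hmean,
    tendsto_nhds_unique ((Complex.continuous_ofReal.tendsto _).comp hmean)
      (hS.tendsto_integral_quadForm hC hφ z)⟩

end Diffusion

section Polarization

variable {m : Type*} [Fintype m]

lemma dotProduct_mulVec_add_single [DecidableEq m] {R : Type*} [CommSemiring R] {B : Matrix m m R}
    (hB : B.IsSymm) (i j : m) :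
    (Pi.single i 1 + Pi.single j 1) ⬝ᵥ B.mulVec (Pi.single i 1 + Pi.single j 1) =
      B i i + B j j + 2 * B i j := by
  simp only [Matrix.mulVec_add, add_dotProduct, dotProduct_add, Matrix.mulVec_single_one,
    single_one_dotProduct, Matrix.col_apply, hB.apply i j]
  ring

lemma integral_entry_eq_of_integral_dotProduct_mulVec {Ω' : Type*} [MeasurableSpace Ω']
    {ν : Measure Ω'} {D : Ω' → Matrix m m ℝ} {B : Matrix m m ℂ} (hD : ∀ᵐ ω ∂ν, (D ω).IsSymm)
    (hB : B.IsSymm)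
    (h : ∀ z : m → ℝ, z ≠ 0 → Integrable (fun ω => z ⬝ᵥ (D ω).mulVec z) ν ∧
      ((∫ ω, z ⬝ᵥ (D ω).mulVec z ∂ν : ℝ) : ℂ) = ∑ i, ∑ j, (z i : ℂ) * B i j * (z j : ℂ))
    (i j : m) :
    Integrable (fun ω => D ω i j) ν ∧ ((∫ ω, D ω i j ∂ν : ℝ) : ℂ) = B i j := by
  classical
  simp only [sum_sum_eq_dotProduct_mulVec] at h
  have hcast (k : m) : (fun a => ((Pi.single k 1 : m → ℝ) a : ℂ)) = Pi.single k 1 := by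
    ext a
    by_cases ha : a = k <;> simp [ha]
  have hdiag (k : m) : Integrable (fun ω => D ω k k) ν ∧
      ((∫ ω, D ω k k ∂ν : ℝ) : ℂ) = B k k := by
    have hk := h (Pi.single k 1) (by simp)
    rw [hcast] at hk
    simpa only [Matrix.mulVec_single_one, single_one_dotProduct, Matrix.col_apply] using hk
  have hcast_add : (fun a => (((Pi.single i 1 + Pi.single j 1 : m → ℝ) a : ℝ) : ℂ)) =
      Pi.single i 1 + Pi.single j 1 := by
    rw [← hcast i, ← hcast j]
    ext a
    simp
  have hne : (Pi.single i 1 + Pi.single j 1 : m → ℝ) ≠ 0 :=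
    (add_pos_of_pos_of_nonneg (by simp) (by simp)).ne'
  obtain ⟨hint, hval⟩ := h _ hne
  rw [hcast_add, dotProduct_mulVec_add_single hB] at hval
  set q := fun ω => (Pi.single i 1 + Pi.single j 1) ⬝ᵥ (D ω).mulVec (Pi.single i 1 + Pi.single j 1)
  have hpolar : (fun ω => (q ω - (D ω i i + D ω j j)) / 2) =ᵐ[ν] fun ω => D ω i j := by
    filter_upwards [hD] with ω hω
    rw [show q ω = _ from dotProduct_mulVec_add_single hω i j]
    ring
  have hdd : Integrable (fun ω => D ω i i + D ω j j) ν := (hdiag i).1.add (hdiag j).1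
  refine ⟨((hint.sub hdd).div_const 2).congr hpolar, ?_⟩
  rw [← integral_congr_ae hpolar, integral_div, integral_sub hint hdd,
    integral_add (hdiag i).1 (hdiag j).1]
  push_cast
  rw [hval, (hdiag i).2, (hdiag j).2]
  ring

end Polarization

lemma isSymm_diffusion {d : ℕ} {Ω : Type*} [MeasurableSpace Ω] (r : CoinIdx d → Fin d → ℤ)
    (μ : Measure Ω) (C : Ω → Matrix.unitaryGroup (CoinIdx d) ℂ) :
    (diffusion r μ C).IsSymm := by
  have h (v i j) : diffusionAt r μ C v i j = diffusionAt r μ C v j i := by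
    simp only [diffusionAt, mul_comm (r _ i : ℂ), mul_comm (meanJump r i : ℂ)]
    simp only [add_comm]
  ext i j
  simp only [diffusion, Matrix.transpose_apply, h _ i j]

end RandomQuantumWalk

theorem mainTheorem9
    (d : ℕ) (r : RandomQuantumWalk.CoinIdx d → Fin d → ℤ)
    {Ω : Type*} [MeasurableSpace Ω] (μ : Measure Ω) [IsProbabilityMeasure μ]
    (C : Ω → Matrix.unitaryGroup (RandomQuantumWalk.CoinIdx d) ℂ)
    (hC : ∀ σ τ, Measurable fun ω =>
      (C ω : Matrix (RandomQuantumWalk.CoinIdx d) (RandomQuantumWalk.CoinIdx d) ℂ) σ τ)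
    (φ₀ : RandomQuantumWalk.CoinSpace d) (hφ₀ : ‖φ₀‖ = 1)
    (hS : RandomQuantumWalk.AssumptionS r μ C)
    {Ω' : Type*} [MeasurableSpace Ω'] (ν : Measure Ω') [IsProbabilityMeasure ν] :
    -- a fixed direction `z` and a limit `D^ω` in distribution
    (∀ z : Fin d → ℝ, z ≠ 0 → ∀ Dlim : Ω' → ℝ,
      TendstoInDistribution
        (fun (n : ℕ) (ω : ℕ → Ω) =>
          RandomQuantumWalk.quadForm r (RandomQuantumWalk.coins C ω) φ₀ z n)
        atTop Dlim (fun _ => Measure.infinitePi fun _ : ℕ => μ) ν →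
      (∀ n : ℕ, Integrable
        (fun ω : ℕ → Ω => RandomQuantumWalk.quadForm r (RandomQuantumWalk.coins C ω) φ₀ z n)
        (Measure.infinitePi fun _ : ℕ => μ)) ∧
      Integrable Dlim ν ∧
      Tendsto
        (fun n : ℕ => ∫ ω : ℕ → Ω,
          RandomQuantumWalk.quadForm r (RandomQuantumWalk.coins C ω) φ₀ z n
            ∂(Measure.infinitePi fun _ : ℕ => μ))
        atTop (𝓝 (∫ ω', Dlim ω' ∂ν)) ∧
      ((∫ ω', Dlim ω' ∂ν : ℝ) : ℂ)
        = ∑ i, ∑ j, (z i : ℂ) * RandomQuantumWalk.diffusion r μ C i j * (z j : ℂ)) ∧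
    -- a random symmetric matrix `𝔻^ω` giving the limits in all directions
    (∀ Dmat : Ω' → Matrix (Fin d) (Fin d) ℝ, (∀ᵐ ω' ∂ν, (Dmat ω').IsSymm) →
      (∀ z : Fin d → ℝ, z ≠ 0 →
        TendstoInDistribution
          (fun (n : ℕ) (ω : ℕ → Ω) =>
            RandomQuantumWalk.quadForm r (RandomQuantumWalk.coins C ω) φ₀ z n)
          atTop (fun ω' => z ⬝ᵥ (Dmat ω').mulVec z)
          (fun _ => Measure.infinitePi fun _ : ℕ => μ) ν) →
      ∀ i j, Integrable (fun ω' => Dmat ω' i j) ν ∧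
        ((∫ ω', Dmat ω' i j ∂ν : ℝ) : ℂ) = RandomQuantumWalk.diffusion r μ C i j) := by
  have : NeZero d := ⟨by
    rintro rfl
    simp [Subsingleton.elim φ₀ 0] at hφ₀⟩
  have hmean {z : Fin d → ℝ} {Z : Ω' → ℝ} :=
    hS.mean_of_tendstoInDistribution hC hφ₀ (ν := ν) (z := z) (Z := Z)
  refine ⟨fun z _ Dlim hD => ⟨fun n => ?_, hmean hD⟩, fun Dmat hsymm hD => ?_⟩
  · exact memLp_one_iff_integrable.1 (RandomQuantumWalk.memLp_quadForm hC hφ₀ z n 1)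
  · refine RandomQuantumWalk.integral_entry_eq_of_integral_dotProduct_mulVec hsymm
      (RandomQuantumWalk.isSymm_diffusion r μ C) fun z hz => ?_
    obtain ⟨hint, -, hval⟩ := hmean (hD z hz)
    exact ⟨hint, hval⟩
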